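/- Let $q$ be a complex number with $0<|q|<1$. For $x\in\mathbb{C}$, $|p|<1$ and $n\ge 0$ write $(x;p)_n=\prod_{i=0}^{n-1}(1-p^i x)$ and $(x;p)_\infty=\prod_{i\ge 0}(1-p^i x)$, and for $x\neq 0$, $p\ne 0$ let $j(x;p)=(x;p)_\infty(p/x;p)_\infty(p;p)_\infty$. For integers $a,m$ with $m>0$ put $J_{a,m}=j(q^a;q^m)$, $\overline{J}_{a,m}=j(-q^a;q^m)$ and $J_m=\prod_{i\ge 1}(1-q^{mi})$. Let $$g(x,p)=x^{-1}\Big(-1+\sum_{n=0}^{\infty}\frac{p^{n^2}}{(x;p)_{n+1}(p/x;p)_n}\Big)$$ be the universal mock theta function, and let $$\overline{\psi}_0(q)=\sum_{n=0}^{\infty}\frac{q^{2n^2}}{(-q;q)_{2n}},\qquad \overline{\psi}_1(q)=\sum_{n=0}^{\infty}\frac{q^{2n^2+2n}}{(-q;q)_{2n+1}}$$ be Andrews' new mock theta functions. Then $$\overline{\psi}_0(q)=2-2q\,g(-q,q^8)-\frac{J_{1,2}\,\overline{J}_{3,8}}{J_2},$$ $$\overline{\psi}_1(q)=2q^2\,g(-q^3,q^8)+\frac{J_{1,2}\,\overline{J}_{1,8}}{J_2}.$$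 -/

import Mathlib

noncomputable section

namespace MockTheta

/-- The finite `q`-Pochhammer symbol `(x; q)_n = ∏_{i=0}^{n-1} (1 - q^i x)`. -/
def qPoch (x q : ℂ) (n : ℕ) : ℂ :=
  ∏ i ∈ Finset.range n, (1 - q ^ i * x)

/-- The infinite `q`-Pochhammer symbol `(x; q)_∞ = ∏_{i ≥ 0} (1 - q^i x)`. -/
def qPochInf (x q : ℂ) : ℂ :=
  ∏' i : ℕ, (1 - q ^ i * x)

/-- The theta function `j(x; q) = (x; q)_∞ (q/x; q)_∞ (q; q)_∞`. -/
def theta (x q : ℂ) : ℂ :=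
  qPochInf x q * qPochInf (q / x) q * qPochInf q q

/-- `J_{a,m} = j(q^a; q^m)`. -/
def J (a : ℤ) (m : ℕ) (q : ℂ) : ℂ :=
  theta (q ^ a) (q ^ m)

/-- `J̄_{a,m} = j(-q^a; q^m)`. -/
def Jbar (a : ℤ) (m : ℕ) (q : ℂ) : ℂ :=
  theta (-q ^ a) (q ^ m)

/-- `J_m = ∏_{i ≥ 1} (1 - q^{m i})`. -/
def Jm (m : ℕ) (q : ℂ) : ℂ :=
  ∏' i : ℕ, (1 - q ^ (m * (i + 1)))

/-- The universal mock theta function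
`g(x, q) = x⁻¹ (-1 + ∑_{n ≥ 0} q^{n²} / ((x; q)_{n+1} (q/x; q)_n))`. -/
def g (x q : ℂ) : ℂ :=
  x⁻¹ * (-1 + ∑' n : ℕ, q ^ (n ^ 2) / (qPoch x q (n + 1) * qPoch (q / x) q n))

/-- `ψ̄₀(q) = ∑_{n ≥ 0} q^{2n²} / (-q; q)_{2n}`. -/
def psiBar₀ (q : ℂ) : ℂ :=
  ∑' n : ℕ, q ^ (2 * n ^ 2) / qPoch (-q) q (2 * n)

/-- `ψ̄₁(q) = ∑_{n ≥ 0} q^{2n²+2n} / (-q; q)_{2n+1}`. -/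
def psiBar₁ (q : ℂ) : ℂ :=
  ∑' n : ℕ, q ^ (2 * n ^ 2 + 2 * n) / qPoch (-q) q (2 * n + 1)

/-! The products and series above converge for `|q| < 1`, so none of the values is a default
value of `∏'` or `∑'`, and the denominator `J_m` does not vanish. -/

theorem multipliable_qPochInf (x : ℂ) {q : ℂ} (hq : ‖q‖ < 1) :
    Multipliable fun i : ℕ => 1 - q ^ i * x := by
  have : Summable fun i : ℕ => ‖-(q ^ i * x)‖ := by
    simpa [norm_mul] using (summable_geometric_of_lt_one (norm_nonneg q) hq).mul_right ‖x‖
  simpa [sub_eq_add_neg] using multipliable_one_add_of_summable this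

theorem summable_of_ratio {f r : ℕ → ℂ} (hf : ∀ n, f (n + 1) = r n * f n)
    (hr : Filter.Tendsto r Filter.atTop (nhds 0)) : Summable f := by
  refine summable_of_ratio_norm_eventually_le (r := 1 / 2) (by norm_num) ?_
  have h := hr.norm
  rw [norm_zero] at h
  filter_upwards [h.eventually_le_const (by norm_num : (0 : ℝ) < 1 / 2)] with n hn
  rw [hf, norm_mul]
  gcongr

theorem tendsto_pow_lin {q : ℂ} (hq : ‖q‖ < 1) (a b : ℕ) (ha : 0 < a) :
    Filter.Tendsto (fun n : ℕ => q ^ (a * n + b)) Filter.atTop (nhds 0) := by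
  refine (tendsto_pow_atTop_nhds_zero_of_norm_lt_one hq).comp ?_
  refine Filter.tendsto_atTop_mono (fun n => ?_) Filter.tendsto_id
  simp only [id]
  nlinarith

theorem summable_g (x : ℂ) {q : ℂ} (hq : ‖q‖ < 1) :
    Summable fun n : ℕ => q ^ (n ^ 2) / (qPoch x q (n + 1) * qPoch (q / x) q n) := by
  refine summable_of_ratio
    (r := fun n => q ^ (2 * n + 1) / ((1 - q ^ (1 * n + 1) * x) * (1 - q ^ (1 * n + 0) * (q / x))))
    (fun n => ?_) ?_
  · simp only [qPoch, Finset.prod_range_succ _ (n + 1), Finset.prod_range_succ _ n]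
    rw [show (n + 1) ^ 2 = n ^ 2 + (2 * n + 1) by ring, pow_add, div_mul_div_comm, one_mul]
    congr 1 <;> ring
  · have h1 := (((tendsto_pow_lin hq 1 1 one_pos).mul_const x).const_sub 1).mul
      (((tendsto_pow_lin hq 1 0 one_pos).mul_const (q / x)).const_sub 1)
    have h := (tendsto_pow_lin hq 2 1 two_pos).div h1 (by simp)
    simpa [Pi.div_def] using h

theorem summable_psiBar₀ {q : ℂ} (hq : ‖q‖ < 1) :
    Summable fun n : ℕ => q ^ (2 * n ^ 2) / qPoch (-q) q (2 * n) := by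
  refine summable_of_ratio
    (r := fun n => q ^ (4 * n + 2) / ((1 - q ^ (2 * n + 0) * -q) * (1 - q ^ (2 * n + 1) * -q)))
    (fun n => ?_) ?_
  · simp only [qPoch, show 2 * (n + 1) = 2 * n + 1 + 1 by ring, Finset.prod_range_succ]
    rw [show 2 * (n + 1) ^ 2 = 2 * n ^ 2 + (4 * n + 2) by ring, pow_add, div_mul_div_comm]
    congr 1 <;> ring
  · have h1 := (((tendsto_pow_lin hq 2 0 two_pos).mul_const (-q)).const_sub 1).mul
      (((tendsto_pow_lin hq 2 1 two_pos).mul_const (-q)).const_sub 1)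
    have h := (tendsto_pow_lin hq 4 2 four_pos).div h1 (by simp)
    simpa [Pi.div_def] using h

theorem summable_psiBar₁ {q : ℂ} (hq : ‖q‖ < 1) :
    Summable fun n : ℕ => q ^ (2 * n ^ 2 + 2 * n) / qPoch (-q) q (2 * n + 1) := by
  refine summable_of_ratio
    (r := fun n => q ^ (4 * n + 4) / ((1 - q ^ (2 * n + 1) * -q) * (1 - q ^ (2 * n + 2) * -q)))
    (fun n => ?_) ?_
  · simp only [qPoch, show 2 * (n + 1) + 1 = 2 * n + 1 + 1 + 1 by ring,
      Finset.prod_range_succ _ (2 * n + 1 + 1), Finset.prod_range_succ _ (2 * n + 1)]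
    rw [show 2 * (n + 1) ^ 2 + 2 * (n + 1) = 2 * n ^ 2 + 2 * n + (4 * n + 4) by ring,
      pow_add _ (2 * n ^ 2 + 2 * n), div_mul_div_comm]
    congr 1 <;> ring
  · have h1 := (((tendsto_pow_lin hq 2 1 two_pos).mul_const (-q)).const_sub 1).mul
      (((tendsto_pow_lin hq 2 2 two_pos).mul_const (-q)).const_sub 1)
    have h := (tendsto_pow_lin hq 4 4 four_pos).div h1 (by simp)
    simpa [Pi.div_def] using h

theorem Jm_ne_zero {m : ℕ} (hm : 0 < m) {q : ℂ} (hq : ‖q‖ < 1) : Jm m q ≠ 0 := by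
  have hqm : ‖q ^ m‖ < 1 := by
    rw [norm_pow]; exact pow_lt_one₀ (norm_nonneg q) hq hm.ne'
  have hs : Summable fun i : ℕ => ‖-(q ^ m) ^ (i + 1)‖ := by
    simpa [norm_pow, pow_succ] using
      (summable_geometric_of_lt_one (norm_nonneg (q ^ m)) hqm).mul_right ‖q ^ m‖
  have h := tprod_one_add_ne_zero_of_summable (f := fun i : ℕ => -(q ^ m) ^ (i + 1))
    (fun i h0 => ?_) hs
  · simpa [Jm, pow_mul, sub_eq_add_neg] using h
  · have h1 : (q ^ m) ^ (i + 1) = 1 := by linear_combination -h0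
    have h2 : ‖q ^ m‖ ^ (i + 1) = 1 := by rw [← norm_pow, h1, norm_one]
    exact (pow_lt_one₀ (norm_nonneg _) hqm (Nat.succ_ne_zero i)).ne h2

end MockTheta

end

/-! Write P = (q²;q²)_∞. A Bailey-type formula expands 1/(-q;q)_{2n+1} as a sum over j of (-1)^j
q^{-j²} times a tail over r ≥ |j|, in which n enters only through reciprocals of (q²;q²)_{n-r} and
(q²;q²)_{n+r+1} (`inv_qPoch_eq_tsum_tailSum`). Cauchy's Durfee-rectangle identity (`tsum_cauchy`)
then evaluates the sum over n, and P·ψ̄ becomes a Hecke-type double sum ∑_j (-1)^j q^{-j²} ∑_{r ≥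
|j|} c_r (`qPochInf_mul_psiBar₀`, `qPochInf_mul_psiBar₁`).

Multiplication by θ(-1;q²) = ∑_a q^{a²-a} removes the tails: in the coefficient with a + j = k,
pairing a with a - 1 telescopes them and leaves the denominator 1 + q^{2k-1}
(`tsum_mul_tsum_tailSum`). The result is twice the single series `lambertTheta q u`, with u = 2 for
ψ̄₀ and u = 4 for ψ̄₁.

This series is compared with its twist by (-1)^k. The twist is a theta quotient, by the partial
fraction expansion of 1/θ (`tsum_alternating_lambertTheta`). The difference (u = 2) or the sum (u =
4) of the two series keeps one parity of k. There `altTheta q (u - 2 * k)` vanishes for every second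
k and is an elementary multiple of `altTheta q 0` for the others, so an Appell–Lerch sum of base q⁸
remains, and this is g (`lambertTheta_two`, `lambertTheta_four`). Product identities for theta
constants finish the proof. -/

noncomputable section

namespace MockTheta

open Filter Topology

/-! ### Summability of series dominated by powers of `q` -/

theorem summable_pow_natAbs {r : ℝ} (h0 : 0 ≤ r) (h1 : r < 1) :
    Summable fun k : ℤ => r ^ k.natAbs := by
  refine Summable.of_nat_of_neg ?_ ?_ <;> simpa using summable_geometric_of_lt_one h0 h1

theorem summable_pow_add {ι κ : Type*} {r : ℝ} (h0 : 0 ≤ r) {v : ι → ℕ} {w : κ → ℕ}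
    (hv : Summable fun i => r ^ v i) (hw : Summable fun j => r ^ w j) :
    Summable fun x : ι × κ => r ^ (v x.1 + w x.2) := by
  simpa [pow_add] using hv.mul_of_nonneg hw (fun _ => by positivity) (fun _ => by positivity)

theorem norm_zpow_le_of_le {q : ℂ} (hq0 : q ≠ 0) (hq1 : ‖q‖ < 1) {e D : ℤ} {m : ℕ}
    (h : (m : ℤ) ≤ e + D) : ‖q ^ e‖ ≤ ‖q‖ ^ (-D) * ‖q‖ ^ m := by
  have hq : 0 < ‖q‖ := norm_pos_iff.2 hq0
  rw [norm_zpow, ← zpow_natCast, ← zpow_add₀ hq.ne']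
  exact zpow_le_zpow_right_of_le_one₀ hq hq1.le (by omega)

/-- The slack D lets a quadratic exponent with a linear part, possibly negative at a few indices, be
compared with a plain weight. -/
theorem summable_zpow_mul {ι : Type*} {q : ℂ} (hq0 : q ≠ 0) (hq1 : ‖q‖ < 1) (w : ι → ℕ)
    (hw : Summable fun i => ‖q‖ ^ w i) {e : ι → ℤ} (D : ℤ) (he : ∀ i, (w i : ℤ) ≤ e i + D)
    {u : ι → ℂ} (hu : ∃ C, ∀ i, ‖u i‖ ≤ C) : Summable fun i => q ^ e i * u i := by
  obtain ⟨C, hC⟩ := hu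
  refine Summable.of_norm_bounded (hw.mul_left (‖q‖ ^ (-D) * C)) fun i => ?_
  rw [norm_mul]
  have h1 := norm_zpow_le_of_le hq0 hq1 (he i)
  calc ‖q ^ e i‖ * ‖u i‖ ≤ (‖q‖ ^ (-D) * ‖q‖ ^ w i) * C := by gcongr; exact hC i
    _ = _ := by ring

theorem summable_int_zpow_mul {q : ℂ} (hq0 : q ≠ 0) (hq1 : ‖q‖ < 1) {e : ℤ → ℤ} (D : ℤ)
    (he : ∀ k, |k| ≤ e k + D) {u : ℤ → ℂ} (hu : ∃ C, ∀ k, ‖u k‖ ≤ C) :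
    Summable fun k => q ^ e k * u k :=
  summable_zpow_mul hq0 hq1 Int.natAbs (summable_pow_natAbs (norm_nonneg _) hq1) D
    (fun k => by simpa using he k) hu

theorem summable_int_prod_zpow_mul {q : ℂ} (hq0 : q ≠ 0) (hq1 : ‖q‖ < 1) {e : ℤ × ℤ → ℤ} (D : ℤ)
    (he : ∀ x, |x.1| + |x.2| ≤ e x + D) {u : ℤ × ℤ → ℂ} (hu : ∃ C, ∀ k, ‖u k‖ ≤ C) :
    Summable fun k => q ^ e k * u k := by
  have hw := summable_pow_natAbs (norm_nonneg q) hq1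
  refine summable_zpow_mul hq0 hq1 (fun x : ℤ × ℤ => x.1.natAbs + x.2.natAbs)
    (summable_pow_add (norm_nonneg q) hw hw) D (fun k => ?_) hu
  rw [Nat.cast_add, Int.natCast_natAbs, Int.natCast_natAbs]
  exact he k

theorem norm_negOnePow (k : ℤ) : ‖(-1 : ℂ) ^ k‖ = 1 := by simp

theorem exists_norm_le_mul {ι : Type*} {u v : ι → ℂ} (hu : ∃ C, ∀ i, ‖u i‖ ≤ C)
    (hv : ∃ C, ∀ i, ‖v i‖ ≤ C) : ∃ C, ∀ i, ‖u i * v i‖ ≤ C := by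
  obtain ⟨C, hC⟩ := hu
  obtain ⟨D, hD⟩ := hv
  refine ⟨C * D, fun i => ?_⟩
  rw [norm_mul]
  exact mul_le_mul (hC i) (hD i) (norm_nonneg _) ((norm_nonneg _).trans (hC i))

theorem exists_norm_negOnePow_le {ι : Type*} (f : ι → ℤ) : ∃ C, ∀ i, ‖(-1 : ℂ) ^ f i‖ ≤ C :=
  ⟨1, fun _ => (norm_negOnePow _).le⟩

theorem exists_norm_le_of_tendsto {u : ℕ → ℂ} {l : ℂ} (h : Tendsto u atTop (𝓝 l)) :
    ∃ C, ∀ n, ‖u n‖ ≤ C := by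
  obtain ⟨C, hC⟩ := (Metric.isBounded_range_of_tendsto u h).exists_norm_le
  exact ⟨C, fun n => hC _ ⟨n, rfl⟩⟩

theorem exists_norm_int_le {u : ℤ → ℂ} (h1 : ∃ C, ∀ n : ℕ, ‖u n‖ ≤ C)
    (h2 : ∃ C, ∀ n : ℕ, ‖u (-n)‖ ≤ C) : ∃ C, ∀ k, ‖u k‖ ≤ C := by
  obtain ⟨C, hC⟩ := h1
  obtain ⟨D, hD⟩ := h2
  refine ⟨max C D, fun k => ?_⟩
  obtain ⟨n, rfl | rfl⟩ := k.eq_nat_or_neg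
  · exact (hC n).trans (le_max_left _ _)
  · exact (hD n).trans (le_max_right _ _)

/-- Both ends converge: the inverse tends to 1 as k → ∞, and to 0 as k → -∞ when x ≠ 0. A vanishing
denominator does no harm, since its inverse is 0 by convention. -/
theorem exists_norm_inv_one_sub_le (x : ℂ) {p : ℂ} (hp0 : p ≠ 0) (hp1 : ‖p‖ < 1) :
    ∃ C, ∀ k : ℤ, ‖(1 - x * p ^ k)⁻¹‖ ≤ C := by
  have ht := tendsto_pow_atTop_nhds_zero_of_norm_lt_one hp1
  refine exists_norm_int_le ?_ ?_
  · refine exists_norm_le_of_tendsto (l := (1 - x * 0)⁻¹) ?_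
    simpa using ((ht.const_mul x).const_sub 1).inv₀ (by simp)
  · rcases eq_or_ne x 0 with rfl | hx
    · exact ⟨1, by simp⟩
    refine exists_norm_le_of_tendsto (l := 0 * (0 - x)⁻¹) ?_
    have h := ht.mul ((ht.sub_const x).inv₀ (by simpa using hx))
    refine h.congr fun n => ?_
    have hpn : p ^ n ≠ 0 := pow_ne_zero _ hp0
    rw [zpow_neg, zpow_natCast, show 1 - x * (p ^ n)⁻¹ = (p ^ n - x) * (p ^ n)⁻¹ by field_simp,
      mul_inv, inv_inv, mul_comm]

/-! ### Finite and infinite products -/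

theorem qPoch_zero (x p : ℂ) : qPoch x p 0 = 1 := by simp [qPoch]

theorem qPoch_succ (x p : ℂ) (n : ℕ) : qPoch x p (n + 1) = qPoch x p n * (1 - p ^ n * x) := by
  simp [qPoch, Finset.prod_range_succ]

theorem tendsto_qPoch (x : ℂ) {p : ℂ} (hp : ‖p‖ < 1) :
    Tendsto (qPoch x p) atTop (𝓝 (qPochInf x p)) :=
  (multipliable_qPochInf x hp).hasProd.tendsto_prod_nat

theorem qPochInf_ne_zero {x p : ℂ} (hp : ‖p‖ < 1) (h : ∀ i : ℕ, 1 - p ^ i * x ≠ 0) :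
    qPochInf x p ≠ 0 := by
  have hs : Summable fun i : ℕ => ‖-(p ^ i * x)‖ := by
    simpa [norm_mul] using (summable_geometric_of_lt_one (norm_nonneg p) hp).mul_right ‖x‖
  have := tprod_one_add_ne_zero_of_summable (f := fun i : ℕ => -(p ^ i * x))
    (fun i => by simpa [sub_eq_add_neg] using h i) hs
  simpa [qPochInf, sub_eq_add_neg] using this

theorem one_sub_ne_zero_of_norm_lt {x : ℂ} (h : ‖x‖ < 1) : 1 - x ≠ 0 := fun h0 => by
  rw [← sub_eq_zero.1 h0] at h
  simp at h

theorem qPochInf_ne_zero_of_norm_lt {x p : ℂ} (hp : ‖p‖ < 1) (hx : ‖x‖ < 1) :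
    qPochInf x p ≠ 0 := by
  refine qPochInf_ne_zero hp fun i => one_sub_ne_zero_of_norm_lt ?_
  rw [norm_mul, norm_pow]
  exact (mul_le_of_le_one_left (norm_nonneg _) (pow_le_one₀ (norm_nonneg _) hp.le)).trans_lt hx

/-- `1 / (p; p)_k`, extended by zero to negative `k`. -/
def recipPoch (p : ℂ) (k : ℤ) : ℂ := if k < 0 then 0 else (qPoch p p k.toNat)⁻¹

theorem recipPoch_natCast (p : ℂ) (n : ℕ) : recipPoch p n = (qPoch p p n)⁻¹ := by
  simp [recipPoch]

theorem recipPoch_of_neg (p : ℂ) {k : ℤ} (hk : k < 0) : recipPoch p k = 0 := by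
  simp [recipPoch, hk]

theorem recipPoch_zero (p : ℂ) : recipPoch p 0 = 1 := by simp [recipPoch, qPoch_zero]

theorem qPoch_self_ne_zero {p : ℂ} (hp : ‖p‖ < 1) (n : ℕ) : qPoch p p n ≠ 0 := by
  refine Finset.prod_ne_zero_iff.2 fun i _ => one_sub_ne_zero_of_norm_lt ?_
  rw [← pow_succ, norm_pow]
  exact pow_lt_one₀ (norm_nonneg _) hp (Nat.succ_ne_zero i)

/-- The extension by zero is consistent with the recursion: at k = -1 the factor 1 - p⁰ vanishes.
Recurrences in n can therefore be checked for all integers r, without boundary cases. -/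
theorem recipPoch_eq {p : ℂ} (hp : ‖p‖ < 1) (k : ℤ) :
    recipPoch p k = (1 - p ^ (k + 1)) * recipPoch p (k + 1) := by
  rcases lt_trichotomy k (-1) with h | rfl | h
  · rw [recipPoch_of_neg p (by omega), recipPoch_of_neg p (by omega), mul_zero]
  · simp [recipPoch]
  · lift k to ℕ using by omega
    have h := qPoch_self_ne_zero hp (k + 1)
    rw [show ((k : ℤ) + 1) = ((k + 1 : ℕ) : ℤ) by simp, recipPoch_natCast, recipPoch_natCast,
      zpow_natCast]
    rw [qPoch_succ] at h ⊢
    have h1 := left_ne_zero_of_mul h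
    have h2 := right_ne_zero_of_mul h
    rw [pow_succ]
    field_simp

theorem tendsto_recipPoch {p : ℂ} (hp : ‖p‖ < 1) :
    Tendsto (recipPoch p) atTop (𝓝 (qPochInf p p)⁻¹) := by
  have h := ((tendsto_qPoch p hp).inv₀ (qPochInf_ne_zero_of_norm_lt hp hp)).comp
    (tendsto_atTop_atTop.2 fun b => ⟨(b : ℤ), fun k hk => by omega⟩ :
      Tendsto Int.toNat atTop atTop)
  refine h.congr' ?_
  filter_upwards [eventually_ge_atTop 0] with k hk
  simp [recipPoch, not_lt.2 hk]

theorem exists_norm_recipPoch_le {p : ℂ} (hp : ‖p‖ < 1) : ∃ C, ∀ k, ‖recipPoch p k‖ ≤ C := by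
  refine exists_norm_int_le
    (exists_norm_le_of_tendsto ((tendsto_recipPoch hp).comp tendsto_natCast_atTop_atTop))
    ⟨1, fun n => ?_⟩
  rcases n with _ | n
  · simp [recipPoch_zero]
  · rw [recipPoch_of_neg p (by push_cast; omega)]
    simp

/-! ### The finite and infinite Jacobi triple product -/

theorem norm_sq_lt_one {s : ℂ} (hs : ‖s‖ < 1) : ‖s ^ 2‖ < 1 := by
  rw [norm_pow]
  exact pow_lt_one₀ (norm_nonneg _) hs two_ne_zero

theorem recipPoch_mul_eq_zero (p : ℂ) {n : ℕ} {r : ℤ} (hr : r ∉ Finset.Icc (-(n : ℤ)) n) :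
    recipPoch p (n - r) * recipPoch p (n + r) = 0 := by
  rw [Finset.mem_Icc, not_and_or] at hr
  rcases hr with h | h
  · rw [recipPoch_of_neg p (show (n : ℤ) + r < 0 by omega), mul_zero]
  · rw [recipPoch_of_neg p (show (n : ℤ) - r < 0 by omega), zero_mul]

theorem summable_mul_recipPoch (p : ℂ) (n : ℕ) (u : ℤ → ℂ) :
    Summable fun r : ℤ => u r * (recipPoch p (n - r) * recipPoch p (n + r)) :=
  (hasSum_sum_of_ne_finset_zero (s := Finset.Icc (-(n : ℤ)) n) fun r hr => by
    rw [recipPoch_mul_eq_zero p hr, mul_zero]).summable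

theorem tsum_mul_recipPoch_zero (p : ℂ) (u : ℤ → ℂ) :
    ∑' r : ℤ, u r * (recipPoch p ((0 : ℕ) - r) * recipPoch p ((0 : ℕ) + r)) = u 0 := by
  rw [tsum_eq_single 0]
  · simp [recipPoch_zero]
  · intro r hr
    rw [recipPoch_mul_eq_zero p (by simpa using hr), mul_zero]

/-- Induction on n through a contiguous relation in r. The base is written s² so that the triangular
exponents r(r-1)/2 become integral powers of s. At x = 1 and x = s² the right side is 0 for n ≥ 1;
later inductions discard their error terms in this way. -/
theorem finite_jacobi_triple_product {s : ℂ} (hs0 : s ≠ 0) (hs1 : ‖s‖ < 1) {x : ℂ} (hx : x ≠ 0)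
    (n : ℕ) :
    ∑' r : ℤ, (-1) ^ r * s ^ (r ^ 2 - r) * x ^ r *
        (recipPoch (s ^ 2) (n - r) * recipPoch (s ^ 2) (n + r))
      = qPoch x (s ^ 2) n * qPoch (s ^ 2 / x) (s ^ 2) n * recipPoch (s ^ 2) (2 * n) := by
  have hp := norm_sq_lt_one hs1
  induction n with
  | zero => rw [tsum_mul_recipPoch_zero]; simp [qPoch_zero, recipPoch_zero]
  | succ n ih =>
    set f : ℕ → ℤ → ℂ := fun n r => (-1) ^ r * s ^ (r ^ 2 - r) * x ^ r *
        (recipPoch (s ^ 2) (n - r) * recipPoch (s ^ 2) (n + r)) with hf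
    have hsum : ∀ n, Summable (f n) := fun n => summable_mul_recipPoch _ n _
    -- All reciprocals reduce to those at n - r + 1 and n + r + 1; what remains is a rational
    -- identity in s^{2r}, s^n, s and x. Summed over r, the shifts r ± 1 disappear.
    have hterm : ∀ r : ℤ, (1 - s ^ (4 * n + 2)) * (1 - s ^ (4 * n + 4)) * f (n + 1) r
        = (1 + s ^ (4 * n + 2)) * f n r - s ^ (2 * n) * x * f n (r - 1)
          - s ^ (2 * n + 2) / x * f n (r + 1) := by
      intro r
      have a1 := recipPoch_eq hp (n - r)
      have a2 := recipPoch_eq hp (n - r - 1)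
      have b1 := recipPoch_eq hp (n + r)
      have b2 := recipPoch_eq hp (n + r - 1)
      rw [sub_add_cancel] at a2 b2
      rw [a1] at a2
      rw [b1] at b2
      simp only [hf]
      push_cast
      rw [show (n : ℤ) - (r - 1) = n - r + 1 by ring, show (n : ℤ) + (r - 1) = n + r - 1 by ring,
        show (n : ℤ) - (r + 1) = n - r - 1 by ring, show (n : ℤ) + (r + 1) = n + r + 1 by ring,
        show (n : ℤ) + 1 - r = n - r + 1 by ring, show (n : ℤ) + 1 + r = n + r + 1 by ring,
        a2, b2, a1, b1]
      set A := recipPoch (s ^ 2) (n - r + 1)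
      set B := recipPoch (s ^ 2) (n + r + 1)
      have e1 : (s ^ 2) ^ ((n : ℤ) - r + 1) = s ^ (2 * n + 2) * s ^ (-2 * r) := by
        simp only [← zpow_natCast, ← zpow_mul, ← zpow_add₀ hs0]; congr 1; push_cast; ring
      have e2 : (s ^ 2) ^ ((n : ℤ) - r) = s ^ (2 * n) * s ^ (-2 * r) := by
        simp only [← zpow_natCast, ← zpow_mul, ← zpow_add₀ hs0]; congr 1; push_cast; ring
      have e3 : (s ^ 2) ^ ((n : ℤ) + r + 1) = s ^ (2 * n + 2) * s ^ (2 * r) := by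
        simp only [← zpow_natCast, ← zpow_mul, ← zpow_add₀ hs0]; congr 1; push_cast; ring
      have e4 : (s ^ 2) ^ ((n : ℤ) + r) = s ^ (2 * n) * s ^ (2 * r) := by
        simp only [← zpow_natCast, ← zpow_mul, ← zpow_add₀ hs0]; congr 1; push_cast; ring
      have e5 : s ^ ((r - 1) ^ 2 - (r - 1)) = s ^ (r ^ 2 - r) * s ^ (-2 * r) * s ^ 2 := by
        simp only [← zpow_natCast, ← zpow_add₀ hs0]; congr 1; push_cast; ring
      have e6 : s ^ ((r + 1) ^ 2 - (r + 1)) = s ^ (r ^ 2 - r) * s ^ (2 * r) := by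
        simp only [← zpow_add₀ hs0]; congr 1; ring
      have e7 : s ^ (-2 * r) = (s ^ (2 * r))⁻¹ := by rw [← zpow_neg]; congr 1; ring
      have h0 : s ^ (2 * r) ≠ 0 := zpow_ne_zero _ hs0
      rw [e1, e2, e3, e4, e5, e6, e7, zpow_sub_one₀ hx, zpow_add_one₀ hx,
        zpow_sub_one₀ (by norm_num : (-1 : ℂ) ≠ 0), zpow_add_one₀ (by norm_num : (-1 : ℂ) ≠ 0)]
      generalize s ^ (2 * r) = y at *
      simp only [pow_add, pow_mul']
      generalize s ^ n = w
      rw [show (4 : ℕ) = 2 * 2 by norm_num, pow_mul, pow_mul]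
      field_simp
      ring
    have hshift : ∀ c : ℤ, ∑' r, f n (r + c) = ∑' r, f n r := fun c =>
      (Equiv.addRight c).tsum_eq (f n)
    have hsummable : ∀ c : ℤ, Summable fun r => f n (r + c) := fun c =>
      (Equiv.addRight c).summable_iff.2 (hsum n)
    have key : (1 - s ^ (4 * n + 2)) * (1 - s ^ (4 * n + 4)) * ∑' r, f (n + 1) r
        = (1 - (s ^ 2) ^ n * x) * (1 - (s ^ 2) ^ n * (s ^ 2 / x)) * ∑' r, f n r := by
      rw [← tsum_mul_left, tsum_congr hterm]
      simp only [sub_eq_add_neg _ (1 : ℤ)]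
      rw [Summable.tsum_sub (((hsum n).mul_left _).sub ((hsummable _).mul_left _))
        ((hsummable _).mul_left _), Summable.tsum_sub ((hsum n).mul_left _)
        ((hsummable _).mul_left _), tsum_mul_left, tsum_mul_left, tsum_mul_left, hshift, hshift]
      field_simp
      ring
    have c1 := recipPoch_eq hp (2 * n)
    have c2 := recipPoch_eq hp (2 * n + 1)
    have e1 : (s ^ 2) ^ (2 * (n : ℤ) + 1) = s ^ (4 * n + 2) := by
      simp only [← zpow_natCast, ← zpow_mul]; congr 1; push_cast; ring
    have e2 : (s ^ 2) ^ (2 * (n : ℤ) + 1 + 1) = s ^ (4 * n + 4) := by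
      simp only [← zpow_natCast, ← zpow_mul]; congr 1; push_cast; ring
    rw [e1, c2, e2] at c1
    have n1 : 1 - s ^ (4 * n + 2) ≠ 0 := one_sub_ne_zero_of_norm_lt (by
      rw [norm_pow]; exact pow_lt_one₀ (norm_nonneg _) hs1 (by omega))
    have n2 : 1 - s ^ (4 * n + 4) ≠ 0 := one_sub_ne_zero_of_norm_lt (by
      rw [norm_pow]; exact pow_lt_one₀ (norm_nonneg _) hs1 (by omega))
    refine mul_left_cancel₀ (mul_ne_zero n1 n2) ?_
    rw [key, ih, c1, qPoch_succ, qPoch_succ]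
    push_cast
    rw [show 2 * ((n : ℤ) + 1) = 2 * n + 1 + 1 by ring]
    ring

/-- A linear part M|r| of a quadratic exponent suffices to absorb x^r: M is taken with both |s|^M
|x| and |s|^M |x⁻¹| at most 1. -/
theorem exists_norm_zpow_mul_le {s : ℂ} (hs0 : s ≠ 0) (hs1 : ‖s‖ < 1) {x : ℂ} (hx : x ≠ 0) :
    ∃ M : ℕ, ∀ r : ℤ, ‖s ^ (M * |r|) * x ^ r‖ ≤ 1 := by
  have ht := tendsto_pow_atTop_nhds_zero_of_lt_one (norm_nonneg s) hs1
  obtain ⟨M, h1, h2⟩ := (((ht.mul_const ‖x‖).eventually_le_const (u := 1) (by simp)).and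
    ((ht.mul_const ‖x⁻¹‖).eventually_le_const (u := 1) (by simp))).exists
  refine ⟨M, fun r => ?_⟩
  obtain ⟨n, rfl | rfl⟩ := r.eq_nat_or_neg
  · rw [Nat.abs_cast, zpow_mul, zpow_natCast, zpow_natCast, zpow_natCast, ← mul_pow, norm_pow,
      norm_mul, norm_pow]
    exact pow_le_one₀ (by positivity) h1
  · rw [abs_neg, Nat.abs_cast, zpow_mul, zpow_natCast, zpow_natCast, zpow_neg, zpow_natCast,
      ← inv_pow, ← mul_pow, norm_pow, norm_mul, norm_pow]
    exact pow_le_one₀ (by positivity) h2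

theorem summable_jacobi {s : ℂ} (hs0 : s ≠ 0) (hs1 : ‖s‖ < 1) {x : ℂ} (hx : x ≠ 0) :
    Summable fun r : ℤ => (-1) ^ r * s ^ (r ^ 2 - r) * x ^ r := by
  obtain ⟨M, hM⟩ := exists_norm_zpow_mul_le hs0 hs1 hx
  have h := summable_int_zpow_mul hs0 hs1 (e := fun r => r ^ 2 - r - M * |r|) ((M + 2 : ℤ) ^ 2)
    (fun r => by
      have : r ≤ |r| := le_abs_self r
      nlinarith [sq_abs r, sq_nonneg (2 * |r| - (M + 2 : ℤ)), abs_nonneg r])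
    (exists_norm_le_mul (exists_norm_negOnePow_le fun r => r) ⟨1, hM⟩)
  refine h.congr fun r => ?_
  have : s ^ (r ^ 2 - r) = s ^ (r ^ 2 - r - M * |r|) * s ^ (M * |r|) := by
    rw [← zpow_add₀ hs0]; congr 1; ring
  rw [this]
  ring

theorem tendsto_int_sub_add (r : ℤ) : Tendsto (fun n : ℕ => (n : ℤ) - r) atTop atTop ∧
    Tendsto (fun n : ℕ => (n : ℤ) + r) atTop atTop :=
  ⟨by simpa [sub_eq_add_neg] using
    tendsto_atTop_add_const_right atTop (-r) (tendsto_natCast_atTop_atTop (R := ℤ)),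
    tendsto_atTop_add_const_right atTop r (tendsto_natCast_atTop_atTop (R := ℤ))⟩

theorem tendsto_tsum_mul_recipPoch {p : ℂ} (hp : ‖p‖ < 1) {u : ℤ → ℂ} (hu : Summable u) :
    Tendsto (fun n : ℕ => ∑' r : ℤ, u r * (recipPoch p (n - r) * recipPoch p (n + r))) atTop
      (𝓝 ((∑' r, u r) * ((qPochInf p p)⁻¹ * (qPochInf p p)⁻¹))) := by
  obtain ⟨C, hC⟩ := exists_norm_recipPoch_le hp
  have hC0 : 0 ≤ C := (norm_nonneg _).trans (hC 0)
  rw [← tsum_mul_right]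
  refine tendsto_tsum_of_dominated_convergence (hu.norm.mul_right (C * C)) (fun r => ?_)
    (Eventually.of_forall fun n r => ?_)
  · obtain ⟨h1, h2⟩ := tendsto_int_sub_add r
    exact (((tendsto_recipPoch hp).comp h1).mul ((tendsto_recipPoch hp).comp h2)).const_mul _
  · rw [norm_mul, norm_mul]
    gcongr
    exacts [hC _, hC _]

theorem jacobi_triple_product {s : ℂ} (hs0 : s ≠ 0) (hs1 : ‖s‖ < 1) {x : ℂ} (hx : x ≠ 0) :
    ∑' r : ℤ, (-1) ^ r * s ^ (r ^ 2 - r) * x ^ r = theta x (s ^ 2) := by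
  have hp := norm_sq_lt_one hs1
  have hP := qPochInf_ne_zero_of_norm_lt hp hp
  have h1 := tendsto_tsum_mul_recipPoch hp (summable_jacobi hs0 hs1 hx)
  simp_rw [finite_jacobi_triple_product hs0 hs1 hx] at h1
  have h2 := ((tendsto_qPoch x hp).mul (tendsto_qPoch (s ^ 2 / x) hp)).mul
    ((tendsto_recipPoch hp).comp (tendsto_atTop_mono (fun n : ℕ => (by omega : (n : ℤ) ≤ 2 * n))
      (tendsto_natCast_atTop_atTop (R := ℤ))))
  have h3 := tendsto_nhds_unique h1 h2
  rw [theta]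
  generalize ∑' r : ℤ, (-1) ^ r * s ^ (r ^ 2 - r) * x ^ r = S at *
  generalize qPochInf (s ^ 2) (s ^ 2) = P at *
  field_simp at h3
  linear_combination h3

/-! ### Partial fractions for the reciprocal of a theta function -/

/-- Multiplying the sum for n + 1 by the two new denominator factors gives the sum for n plus
multiples of the finite triple product at x = 1 and x = s², which are both zero. The limit n → ∞ is
the expansion of 1/θ; the finite form is needed to expand the summands of g. -/
theorem finite_partial_fractions {s : ℂ} (hs0 : s ≠ 0) (hs1 : ‖s‖ < 1) {z : ℂ} (hz0 : z ≠ 0)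
    (hz : ∀ k : ℤ, 1 - z * (s ^ 2) ^ k ≠ 0) (n : ℕ) :
    ∑' r : ℤ, (-1) ^ r * s ^ (r ^ 2 + r) * (1 - z * (s ^ 2) ^ r)⁻¹ *
        (recipPoch (s ^ 2) (n - r) * recipPoch (s ^ 2) (n + r))
      = (qPoch z (s ^ 2) (n + 1) * qPoch (s ^ 2 / z) (s ^ 2) n)⁻¹ := by
  have hp := norm_sq_lt_one hs1
  have hs2 : s ^ 2 ≠ 0 := pow_ne_zero _ hs0
  induction n with
  | zero => rw [tsum_mul_recipPoch_zero]; simp [qPoch_zero, qPoch_succ]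
  | succ n ih =>
    set f : ℕ → ℤ → ℂ := fun n r => (-1) ^ r * s ^ (r ^ 2 + r) * (1 - z * (s ^ 2) ^ r)⁻¹ *
        (recipPoch (s ^ 2) (n - r) * recipPoch (s ^ 2) (n + r)) with hf
    have hsum : ∀ n, Summable (f n) := fun n => summable_mul_recipPoch _ n _
    set v : ℂ → ℤ → ℂ := fun x r => (-1) ^ r * s ^ (r ^ 2 - r) * x ^ r *
        (recipPoch (s ^ 2) ((n + 1 : ℕ) - r) * recipPoch (s ^ 2) ((n + 1 : ℕ) + r)) with hv
    have hvsum : ∀ x, Summable (v x) := fun x => summable_mul_recipPoch _ (n + 1) _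
    have hv1 : ∑' r, v 1 r = 0 := by
      rw [hv, finite_jacobi_triple_product hs0 hs1 one_ne_zero]
      simp [qPoch, Finset.prod_range_succ']
    have hv2 : ∑' r, v (s ^ 2) r = 0 := by
      rw [hv, finite_jacobi_triple_product hs0 hs1 hs2, div_self hs2]
      simp [qPoch, Finset.prod_range_succ']
    have hterm : ∀ r : ℤ, (1 - (s ^ 2) ^ (n + 1) * z) * (1 - (s ^ 2) ^ (n + 1) * z⁻¹) * f (n + 1) r
        = f n r + ((s ^ 2) ^ (n + 1) * v 1 r - (s ^ 2) ^ (n + 1) * z⁻¹ * v (s ^ 2) r) := by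
      intro r
      have a1 := recipPoch_eq hp (n - r)
      have b1 := recipPoch_eq hp (n + r)
      simp only [hf, hv]
      push_cast
      rw [show (n : ℤ) + 1 - r = n - r + 1 by ring, show (n : ℤ) + 1 + r = n + r + 1 by ring,
        a1, b1]
      have e1 : (s ^ 2) ^ ((n : ℤ) - r + 1) = (s ^ 2) ^ (n + 1) * ((s ^ 2) ^ r)⁻¹ := by
        rw [← zpow_natCast (s ^ 2) (n + 1), ← zpow_neg, ← zpow_add₀ hs2]; congr 1; push_cast; ring
      have e2 : (s ^ 2) ^ ((n : ℤ) + r + 1) = (s ^ 2) ^ (n + 1) * (s ^ 2) ^ r := by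
        rw [← zpow_natCast (s ^ 2) (n + 1), ← zpow_add₀ hs2]; congr 1; push_cast; ring
      have e3 : s ^ (r ^ 2 + r) = s ^ (r ^ 2 - r) * (s ^ 2) ^ r := by
        simp only [← zpow_natCast, ← zpow_mul, ← zpow_add₀ hs0]; congr 1; push_cast; ring
      have h0 : (s ^ 2) ^ r ≠ 0 := zpow_ne_zero _ hs2
      have h1 := hz r
      rw [e1, e2, e3, one_zpow]
      generalize (s ^ 2) ^ r = y at *
      field_simp
      ring
    have key : (1 - (s ^ 2) ^ (n + 1) * z) * (1 - (s ^ 2) ^ (n + 1) * z⁻¹) * ∑' r, f (n + 1) r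
        = ∑' r, f n r := by
      rw [← tsum_mul_left, tsum_congr hterm, Summable.tsum_add (hsum n)
        (((hvsum _).mul_left _).sub ((hvsum _).mul_left _)),
        Summable.tsum_sub ((hvsum _).mul_left _) ((hvsum _).mul_left _), tsum_mul_left,
        tsum_mul_left, hv1, hv2]
      ring
    have n1 : 1 - (s ^ 2) ^ (n + 1) * z ≠ 0 := by
      have := hz (n + 1 : ℕ)
      rwa [zpow_natCast, mul_comm] at this
    have n2 : 1 - (s ^ 2) ^ (n + 1) * z⁻¹ ≠ 0 := by
      have := hz (-(n + 1 : ℕ))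
      rw [zpow_neg, zpow_natCast] at this
      intro h
      apply this
      have : (s ^ 2) ^ (n + 1) = z := by field_simp at h; linear_combination -h
      rw [this, mul_inv_cancel₀ hz0, sub_self]
    refine mul_left_cancel₀ (mul_ne_zero n1 n2) ?_
    rw [key, ih, qPoch_succ z _ (n + 1), qPoch_succ (s ^ 2 / z), mul_inv, mul_inv, mul_inv, mul_inv,
      show (s ^ 2) ^ n * (s ^ 2 / z) = (s ^ 2) ^ (n + 1) * z⁻¹ by ring]
    generalize 1 - (s ^ 2) ^ (n + 1) * z = A at *
    generalize 1 - (s ^ 2) ^ (n + 1) * z⁻¹ = B at *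
    field_simp

theorem summable_partial_fractions {s : ℂ} (hs0 : s ≠ 0) (hs1 : ‖s‖ < 1) (z : ℂ) :
    Summable fun r : ℤ => (-1) ^ r * s ^ (r ^ 2 + r) * (1 - z * (s ^ 2) ^ r)⁻¹ := by
  have h := summable_int_zpow_mul hs0 hs1 (e := fun r => r ^ 2 + r) 1
    (fun r => by cases abs_cases r <;> nlinarith [sq_nonneg (r + 1)])
    (exists_norm_le_mul (exists_norm_negOnePow_le fun r => r)
      (exists_norm_inv_one_sub_le z (pow_ne_zero 2 hs0) (norm_sq_lt_one hs1)))
  exact h.congr fun r => by ring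

theorem theta_ne_zero {x p : ℂ} (hp : ‖p‖ < 1) (hx0 : x ≠ 0)
    (hx : ∀ k : ℤ, 1 - x * p ^ k ≠ 0) : theta x p ≠ 0 := by
  refine mul_ne_zero (mul_ne_zero (qPochInf_ne_zero hp fun i => ?_)
    (qPochInf_ne_zero hp fun i => ?_)) (qPochInf_ne_zero_of_norm_lt hp hp)
  · simpa [mul_comm] using hx i
  · intro h
    apply hx (-(i + 1 : ℕ))
    rw [zpow_neg, zpow_natCast]
    have : p ^ (i + 1) = x := by field_simp at h; linear_combination -h
    rw [this, mul_inv_cancel₀ hx0, sub_self]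

theorem theta_mul_partial_fractions {s : ℂ} (hs0 : s ≠ 0) (hs1 : ‖s‖ < 1) {z : ℂ} (hz0 : z ≠ 0)
    (hz : ∀ k : ℤ, 1 - z * (s ^ 2) ^ k ≠ 0) :
    theta z (s ^ 2) * ∑' r : ℤ, (-1) ^ r * s ^ (r ^ 2 + r) * (1 - z * (s ^ 2) ^ r)⁻¹
      = qPochInf (s ^ 2) (s ^ 2) ^ 3 := by
  have hp := norm_sq_lt_one hs1
  have hP := qPochInf_ne_zero_of_norm_lt hp hp
  have hth := theta_ne_zero hp hz0 hz
  rw [theta] at hth ⊢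
  have h1 := tendsto_tsum_mul_recipPoch hp (summable_partial_fractions hs0 hs1 z)
  simp_rw [finite_partial_fractions hs0 hs1 hz0 hz] at h1
  have h2 := ((((tendsto_qPoch z hp).comp (tendsto_add_atTop_nat 1)).mul
    (tendsto_qPoch (s ^ 2 / z) hp))).inv₀ (left_ne_zero_of_mul hth)
  have h3 := tendsto_nhds_unique h1 h2
  have := left_ne_zero_of_mul (left_ne_zero_of_mul hth)
  have := right_ne_zero_of_mul (left_ne_zero_of_mul hth)
  generalize ∑' r : ℤ, (-1) ^ r * s ^ (r ^ 2 + r) * (1 - z * (s ^ 2) ^ r)⁻¹ = S at *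
  field_simp at h3
  linear_combination qPochInf (s ^ 2) (s ^ 2) * h3

/-! ### Cauchy's identity for Durfee rectangles -/

theorem norm_pow_sq_add_le {p : ℂ} (hp : ‖p‖ < 1) (s m : ℕ) : ‖p ^ (m ^ 2 + s * m)‖ ≤ ‖p‖ ^ m := by
  rw [norm_pow]
  exact pow_le_pow_of_le_one (norm_nonneg _) hp.le (by nlinarith [Nat.zero_le (s * m)])

theorem summable_cauchy {p : ℂ} (hp : ‖p‖ < 1) (s : ℕ) :
    Summable fun m : ℕ => p ^ (m ^ 2 + s * m) * (recipPoch p m * recipPoch p (m + s)) := by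
  obtain ⟨C, hC⟩ := exists_norm_recipPoch_le hp
  have hC0 : 0 ≤ C := (norm_nonneg _).trans (hC 0)
  refine Summable.of_norm_bounded
    ((summable_geometric_of_lt_one (norm_nonneg p) hp).mul_right (C * C)) fun m => ?_
  rw [norm_mul, norm_mul]
  gcongr
  exacts [norm_pow_sq_add_le hp s m, hC _, hC _]

theorem tendsto_cauchy {p : ℂ} (hp : ‖p‖ < 1) :
    Tendsto (fun s : ℕ => ∑' m : ℕ, p ^ (m ^ 2 + s * m) * (recipPoch p m * recipPoch p (m + s)))
      atTop (𝓝 (qPochInf p p)⁻¹) := by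
  obtain ⟨C, hC⟩ := exists_norm_recipPoch_le hp
  have hC0 : 0 ≤ C := (norm_nonneg _).trans (hC 0)
  rw [← tsum_ite_eq (0 : ℕ) fun _ => (qPochInf p p)⁻¹]
  refine tendsto_tsum_of_dominated_convergence
    ((summable_geometric_of_lt_one (norm_nonneg p) hp).mul_right (C * C)) (fun m => ?_)
    (Eventually.of_forall fun s m => ?_)
  · have h1 : Tendsto (fun s : ℕ => recipPoch p (m + s)) atTop (𝓝 (qPochInf p p)⁻¹) := by
      simpa [add_comm, Function.comp_def] using (tendsto_recipPoch hp).comp (tendsto_int_sub_add m).2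
    rcases Nat.eq_zero_or_pos m with rfl | hm
    · simpa [recipPoch_zero] using h1
    · have h2 := ((tendsto_pow_lin hp m (m ^ 2) hm).mul (h1.const_mul (recipPoch p m)))
      rw [if_neg hm.ne']
      simpa [add_comm, mul_comm m] using h2
  · rw [norm_mul, norm_mul]
    gcongr
    exacts [norm_pow_sq_add_le hp s m, hC _, hC _]

/-- Let F_s be the left side and D_s = F_s - F_{s+1}. Then D_s = -p^{s+1} D_{s+1}, so |D_s| is
nondecreasing in s. Since F_s converges, D_s tends to 0, hence every D_s is 0 and F_s equals its
limit. -/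
theorem tsum_cauchy {p : ℂ} (hp : ‖p‖ < 1) (s : ℕ) :
    ∑' m : ℕ, p ^ (m ^ 2 + s * m) * (recipPoch p m * recipPoch p (m + s)) = (qPochInf p p)⁻¹ := by
  set f : ℕ → ℕ → ℂ := fun s m => p ^ (m ^ 2 + s * m) * (recipPoch p m * recipPoch p (m + s))
    with hf
  have hsum : ∀ s, Summable (f s) := summable_cauchy hp
  have hrec : ∀ s, (∑' m, f s m) - ∑' m, f (s + 1) m
      = p ^ (s + 1) * ((∑' m, f (s + 2) m) - ∑' m, f (s + 1) m) := by
    intro s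
    -- The factor 1 - p^m removes the term m = 0 and lowers the index of `recipPoch p m`, so that
    -- shifting m by one produces `f (s + 2)`.
    have h0 : ∀ m, f s m - f (s + 1) m + p ^ (s + 1) * f (s + 1) m
        = p ^ (m ^ 2 + s * m) * ((1 - p ^ m) * recipPoch p m * recipPoch p (m + s + 1)) := by
      intro m
      have a1 := recipPoch_eq hp (m + s)
      have e : p ^ ((m : ℤ) + s + 1) = p ^ (m + s + 1) := by
        rw [← zpow_natCast]; push_cast; rfl
      simp only [hf]
      push_cast
      rw [← add_assoc, a1, e]
      ring
    have hs := ((hsum s).sub (hsum (s + 1))).add ((hsum (s + 1)).mul_left (p ^ (s + 1)))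
    have h1 : ∑' m, (f s m - f (s + 1) m + p ^ (s + 1) * f (s + 1) m)
        = p ^ (s + 1) * ∑' m, f (s + 2) m := by
      rw [hs.tsum_eq_zero_add, ← tsum_mul_left, h0]
      simp only [pow_zero, sub_self, zero_mul, mul_zero, zero_add]
      refine tsum_congr fun m => ?_
      have a1 := recipPoch_eq hp m
      have e : p ^ ((m : ℤ) + 1) = p ^ (m + 1) := by
        rw [← zpow_natCast]; push_cast; rfl
      rw [e] at a1
      rw [h0]
      simp only [hf]
      push_cast
      rw [← a1, show (m : ℤ) + 1 + s + 1 = m + (s + 2) by ring]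
      ring
    rw [Summable.tsum_add ((hsum s).sub (hsum (s + 1))) ((hsum (s + 1)).mul_left _),
      Summable.tsum_sub (hsum s) (hsum (s + 1)), tsum_mul_left] at h1
    linear_combination h1
  have hlim : Tendsto (fun s => ∑' m, f s m) atTop (𝓝 (qPochInf p p)⁻¹) := tendsto_cauchy hp
  have hle : ∀ s, ‖(∑' m, f s m) - ∑' m, f (s + 1) m‖
      ≤ ‖(∑' m, f (s + 1) m) - ∑' m, f (s + 1 + 1) m‖ := by
    intro s
    rw [hrec s, norm_mul, norm_sub_rev, norm_pow]
    exact mul_le_of_le_one_left (norm_nonneg _) (pow_le_one₀ (norm_nonneg _) hp.le)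
  have hmono : Monotone fun s => ‖(∑' m, f s m) - ∑' m, f (s + 1) m‖ := monotone_nat_of_le_succ hle
  have hzero : Tendsto (fun s => ‖(∑' m, f s m) - ∑' m, f (s + 1) m‖) atTop (𝓝 0) := by
    have h := (hlim.sub (hlim.comp (tendsto_add_atTop_nat 1))).norm
    rw [sub_self, norm_zero] at h
    exact h
  have heq : ∀ s, ∑' m, f (s + 1) m = ∑' m, f s m := fun s =>
    (sub_eq_zero.1 (norm_le_zero_iff.1 (hmono.ge_of_tendsto hzero s))).symm
  have hconst : ∀ s, ∑' m, f s m = ∑' m, f 0 m := fun s => by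
    induction s with
    | zero => rfl
    | succ s ih => rw [heq, ih]
  have h := tendsto_nhds_unique hlim (tendsto_const_nhds.congr fun s => (hconst s).symm)
  rw [hconst, ← h]

/-- The terms n < r vanish, and n = i + r turns the rest into Cauchy's identity with s = 2r + ε. The
values ε = 0 and ε = 1 serve the two shapes of Bailey pair. -/
theorem tsum_sq_mul_recipPoch_nat {p : ℂ} (hp : ‖p‖ < 1) (ε r : ℕ) :
    ∑' n : ℕ, p ^ (n ^ 2 + ε * n) * (recipPoch p (n - r) * recipPoch p (n + r + ε))
      = p ^ (r ^ 2 + ε * r) * (qPochInf p p)⁻¹ := by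
  have h0 : ∀ i : ℕ, p ^ ((i + r) ^ 2 + ε * (i + r)) *
      (recipPoch p ((i + r : ℕ) - r) * recipPoch p ((i + r : ℕ) + r + ε))
      = p ^ (r ^ 2 + ε * r) *
        (p ^ (i ^ 2 + (2 * r + ε) * i) * (recipPoch p i * recipPoch p (i + (2 * r + ε : ℕ)))) := by
    intro i
    push_cast
    rw [show (i : ℤ) + r - r = i by ring, show (i : ℤ) + r + r + ε = i + (2 * r + ε) by ring]
    ring
  have hs : Summable fun n : ℕ =>
      p ^ (n ^ 2 + ε * n) * (recipPoch p (n - r) * recipPoch p (n + r + ε)) := by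
    rw [← summable_nat_add_iff r]
    simp_rw [h0]
    exact (summable_cauchy hp _).mul_left _
  rw [← hs.sum_add_tsum_nat_add r, Finset.sum_eq_zero, zero_add]
  · simp_rw [h0]
    rw [tsum_mul_left, tsum_cauchy hp]
  · intro i hi
    rw [recipPoch_of_neg p (show (i : ℤ) - r < 0 by simpa using hi)]
    simp

theorem tsum_sq_mul_recipPoch {p : ℂ} (hp : ‖p‖ < 1) (r : ℤ) :
    ∑' n : ℕ, p ^ (n ^ 2) * (recipPoch p (n - r) * recipPoch p (n + r))
      = p ^ (r ^ 2) * (qPochInf p p)⁻¹ := by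
  obtain ⟨m, rfl | rfl⟩ := r.eq_nat_or_neg
  · simpa [← zpow_natCast] using tsum_sq_mul_recipPoch_nat hp 0 m
  · have := tsum_sq_mul_recipPoch_nat hp 0 m
    simpa [← zpow_natCast, mul_comm (recipPoch p (_ - _)), ← sub_eq_add_neg] using this

/-! ### The universal mock theta function as an Appell–Lerch sum -/

/-- A limiting case of Bailey's lemma: the order of summation is exchanged and the sum over n is
Cauchy's. -/
theorem tsum_sq_mul_tsum_recipPoch {p : ℂ} (hp : ‖p‖ < 1) {u : ℤ → ℂ} (hu : Summable u) :
    ∑' n : ℕ, p ^ (n ^ 2) * ∑' r : ℤ, u r * (recipPoch p (n - r) * recipPoch p (n + r))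
      = (qPochInf p p)⁻¹ * ∑' r : ℤ, u r * p ^ (r ^ 2) := by
  obtain ⟨C, hC⟩ := exists_norm_recipPoch_le hp
  have hC0 : 0 ≤ C := (norm_nonneg _).trans (hC 0)
  have hsum : Summable (Function.uncurry fun (n : ℕ) (r : ℤ) => p ^ (n ^ 2) *
      (u r * (recipPoch p (n - r) * recipPoch p (n + r)))) := by
    refine Summable.of_norm_bounded (((summable_geometric_of_lt_one (norm_nonneg _) hp).mul_of_nonneg
      hu.norm (fun _ => by positivity) (fun _ => norm_nonneg _)).mul_right (C * C)) ?_
    rintro ⟨n, r⟩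
    simp only [Function.uncurry]
    rw [norm_mul, norm_mul, norm_mul (recipPoch _ _), ← mul_assoc]
    gcongr
    · simpa using norm_pow_sq_add_le hp 0 n
    · exact hC _
    · exact hC _
  simp_rw [← tsum_mul_left]
  rw [← hsum.tsum_comm]
  refine tsum_congr fun r => ?_
  calc _ = u r * ∑' n : ℕ, p ^ (n ^ 2) * (recipPoch p (n - r) * recipPoch p (n + r)) := by
        rw [← tsum_mul_left]
        exact tsum_congr fun n => by ring
    _ = _ := by rw [tsum_sq_mul_recipPoch hp]; ring

/-- Bailey's lemma is applied to the finite triple product at x = s², which vanishes for n ≥ 1, so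
only n = 0 contributes. -/
theorem tsum_pentagonal {s : ℂ} (hs0 : s ≠ 0) (hs1 : ‖s‖ < 1) :
    ∑' r : ℤ, (-1) ^ r * s ^ (3 * r ^ 2 + r) = qPochInf (s ^ 2) (s ^ 2) := by
  have hp := norm_sq_lt_one hs1
  have hP := qPochInf_ne_zero_of_norm_lt hp hp
  have hs2 : s ^ 2 ≠ 0 := pow_ne_zero 2 hs0
  have h := tsum_sq_mul_tsum_recipPoch hp (summable_jacobi hs0 hs1 hs2)
  simp_rw [finite_jacobi_triple_product hs0 hs1 hs2] at h
  rw [tsum_eq_single 0] at h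
  · have h2 : ∑' r : ℤ, (-1) ^ r * s ^ (3 * r ^ 2 + r)
        = ∑' r : ℤ, (-1) ^ r * s ^ (r ^ 2 - r) * (s ^ 2) ^ r * (s ^ 2) ^ (r ^ 2) := by
      refine tsum_congr fun r => ?_
      have e : s ^ (3 * r ^ 2 + r) = s ^ (r ^ 2 - r) * (s ^ 2) ^ r * (s ^ 2) ^ (r ^ 2) := by
        simp only [← zpow_natCast, ← zpow_mul, ← zpow_add₀ hs0]; congr 1; push_cast; ring
      rw [e]
      ring
    rw [h2]
    simp only [qPoch_zero, Nat.cast_zero, mul_zero, recipPoch_zero] at h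
    field_simp at h
    simpa using h.symm
  · intro n hn
    obtain ⟨m, rfl⟩ := Nat.exists_eq_succ_of_ne_zero hn
    rw [div_self hs2]
    simp [qPoch, Finset.prod_range_succ']

theorem summable_appell {s : ℂ} (hs0 : s ≠ 0) (hs1 : ‖s‖ < 1) {v : ℤ → ℂ}
    (hv : ∃ C, ∀ r, ‖v r‖ ≤ C) : Summable fun r : ℤ => (-1) ^ r * s ^ (3 * r ^ 2 + r) * v r := by
  have h := summable_int_zpow_mul hs0 hs1 (e := fun r => 3 * r ^ 2 + r) 1
    (fun r => by cases abs_cases r <;> nlinarith [sq_nonneg (r + 1)])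
    (exists_norm_le_mul (exists_norm_negOnePow_le fun r => r) hv)
  exact h.congr fun r => by ring

theorem qPochInf_mul_one_add_g {s : ℂ} (hs0 : s ≠ 0) (hs1 : ‖s‖ < 1) {z : ℂ} (hz0 : z ≠ 0)
    (hz : ∀ k : ℤ, 1 - z * (s ^ 2) ^ k ≠ 0) :
    qPochInf (s ^ 2) (s ^ 2) * (1 + z * g z (s ^ 2))
      = ∑' r : ℤ, (-1) ^ r * s ^ (3 * r ^ 2 + r) * (1 - z * (s ^ 2) ^ r)⁻¹ := by
  have hp := norm_sq_lt_one hs1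
  have hP := qPochInf_ne_zero_of_norm_lt hp hp
  have h := tsum_sq_mul_tsum_recipPoch hp (summable_partial_fractions hs0 hs1 z)
  simp_rw [finite_partial_fractions hs0 hs1 hz0 hz, ← div_eq_mul_inv] at h
  have h2 : ∑' r : ℤ, (-1) ^ r * s ^ (3 * r ^ 2 + r) * (1 - z * (s ^ 2) ^ r)⁻¹
      = ∑' r : ℤ, (-1) ^ r * s ^ (r ^ 2 + r) / (1 - z * (s ^ 2) ^ r) * (s ^ 2) ^ (r ^ 2) := by
    refine tsum_congr fun r => ?_
    have e : s ^ (3 * r ^ 2 + r) = s ^ (r ^ 2 + r) * (s ^ 2) ^ (r ^ 2) := by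
      simp only [← zpow_natCast, ← zpow_mul, ← zpow_add₀ hs0]; congr 1; push_cast; ring
    rw [e]
    ring
  rw [g, h, ← h2]
  field_simp
  ring

/-- The pentagonal series is subtracted from the sum for 1 + z g, using 1/(1 - y) - 1 = y/(1 - y)
with y = z s^{2r}. -/
theorem qPochInf_mul_g_eq_appell {s : ℂ} (hs0 : s ≠ 0) (hs1 : ‖s‖ < 1) {z : ℂ} (hz0 : z ≠ 0)
    (hz : ∀ k : ℤ, 1 - z * (s ^ 2) ^ k ≠ 0) :
    qPochInf (s ^ 2) (s ^ 2) * g z (s ^ 2)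
      = ∑' r : ℤ, (-1) ^ r * s ^ (3 * r ^ 2 + 3 * r) * (1 - z * (s ^ 2) ^ r)⁻¹ := by
  have hb := exists_norm_inv_one_sub_le z (pow_ne_zero 2 hs0) (norm_sq_lt_one hs1)
  have h := qPochInf_mul_one_add_g hs0 hs1 hz0 hz
  have h1 : z * ∑' r : ℤ, (-1) ^ r * s ^ (3 * r ^ 2 + 3 * r) * (1 - z * (s ^ 2) ^ r)⁻¹
      = (∑' r : ℤ, (-1) ^ r * s ^ (3 * r ^ 2 + r) * (1 - z * (s ^ 2) ^ r)⁻¹)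
        - ∑' r : ℤ, (-1) ^ r * s ^ (3 * r ^ 2 + r) * 1 := by
    rw [← tsum_mul_left, ← Summable.tsum_sub (summable_appell hs0 hs1 hb)
      (summable_appell hs0 hs1 ⟨1, fun _ => by simp⟩)]
    refine tsum_congr fun r => ?_
    have e : s ^ (3 * r ^ 2 + 3 * r) = s ^ (3 * r ^ 2 + r) * (s ^ 2) ^ r := by
      simp only [← zpow_natCast, ← zpow_mul, ← zpow_add₀ hs0]; congr 1; push_cast; ring
    have := hz r
    rw [e]
    field_simp
    ring
  simp only [mul_one] at h1
  rw [← h, tsum_pentagonal hs0 hs1] at h1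
  refine mul_left_cancel₀ hz0 ?_
  rw [h1]
  ring

/-! ### Partial fractions for quotients of theta functions -/

/-- The reflection k ↦ 1 + 2b - k fixes the exponent and reverses the sign. -/
theorem tsum_alternating_eq_zero (s : ℂ) (b : ℤ) :
    ∑' k : ℤ, (-1) ^ k * s ^ (k ^ 2 - k - 2 * k * b) = 0 := by
  have h := (Equiv.subLeft (1 + 2 * b)).tsum_eq fun k : ℤ => (-1 : ℂ) ^ k * s ^ (k ^ 2 - k - 2 * k * b)
  have h2 : ∀ k : ℤ, (-1 : ℂ) ^ (Equiv.subLeft (1 + 2 * b) k) *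
      s ^ ((Equiv.subLeft (1 + 2 * b) k) ^ 2 - Equiv.subLeft (1 + 2 * b) k
        - 2 * Equiv.subLeft (1 + 2 * b) k * b) = -((-1) ^ k * s ^ (k ^ 2 - k - 2 * k * b)) := by
    intro k
    rw [Equiv.subLeft_apply, show 1 + 2 * b - k = 1 + k + 2 * (b - k) by ring,
      zpow_add₀ (by norm_num), zpow_add₀ (by norm_num), zpow_mul]
    rw [show (1 + k + 2 * (b - k)) ^ 2 - (1 + k + 2 * (b - k)) - 2 * (1 + k + 2 * (b - k)) * b
      = k ^ 2 - k - 2 * k * b by ring]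
    simp
  rw [tsum_congr h2, tsum_neg] at h
  linear_combination (-1 / 2) * h

theorem summable_partial_fractions_shift {s : ℂ} (hs0 : s ≠ 0) (hs1 : ‖s‖ < 1) (x : ℂ) (b : ℤ) :
    Summable fun k : ℤ => (-1) ^ k * s ^ (k ^ 2 + k - 2 * k * b) * (1 - x * (s ^ 2) ^ k)⁻¹ := by
  have h := summable_int_zpow_mul hs0 hs1 (e := fun k => k ^ 2 + k - 2 * k * b)
    (b ^ 2 + (1 - b) ^ 2)
    (fun k => by
      cases abs_cases k <;>
        nlinarith [sq_nonneg (k - b), sq_nonneg (k + 1 - b), sq_nonneg b, sq_nonneg (1 - b)])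
    (exists_norm_le_mul (exists_norm_negOnePow_le fun r => r)
      (exists_norm_inv_one_sub_le x (pow_ne_zero 2 hs0) (norm_sq_lt_one hs1)))
  exact h.congr fun r => by ring

/-- Raising b by one multiplies the sum by x, because the difference cancels the denominator and
leaves an alternating series equal to zero. -/
theorem tsum_partial_fractions_shift {s : ℂ} (hs0 : s ≠ 0) (hs1 : ‖s‖ < 1) {x : ℂ} (hx0 : x ≠ 0)
    (hx : ∀ k : ℤ, 1 - x * (s ^ 2) ^ k ≠ 0) (b : ℤ) :
    ∑' k : ℤ, (-1) ^ k * s ^ (k ^ 2 + k - 2 * k * b) * (1 - x * (s ^ 2) ^ k)⁻¹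
      = x ^ b * ∑' k : ℤ, (-1) ^ k * s ^ (k ^ 2 + k) * (1 - x * (s ^ 2) ^ k)⁻¹ := by
  set g : ℤ → ℤ → ℂ := fun b k =>
    (-1) ^ k * s ^ (k ^ 2 + k - 2 * k * b) * (1 - x * (s ^ 2) ^ k)⁻¹ with hg
  have hsum : ∀ b, Summable (g b) := summable_partial_fractions_shift hs0 hs1 x
  have hstep : ∀ b, ∑' k, g (b + 1) k = x * ∑' k, g b k := by
    intro b
    have hterm : ∀ k, g (b + 1) k - x * g b k = (-1) ^ k * s ^ (k ^ 2 - k - 2 * k * b) := by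
      intro k
      have e1 : s ^ (k ^ 2 + k - 2 * k * (b + 1)) = s ^ (k ^ 2 - k - 2 * k * b) := by
        congr 1; ring
      have e2 : s ^ (k ^ 2 + k - 2 * k * b) = s ^ (k ^ 2 - k - 2 * k * b) * (s ^ 2) ^ k := by
        simp only [← zpow_natCast, ← zpow_mul, ← zpow_add₀ hs0]; congr 1; push_cast; ring
      have := hx k
      simp only [hg]
      rw [e1, e2]
      field_simp
    have h := tsum_alternating_eq_zero s b
    rw [← tsum_congr hterm, Summable.tsum_sub (hsum _) ((hsum _).mul_left _), tsum_mul_left] at h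
    exact sub_eq_zero.1 h
  have h0 : ∑' k : ℤ, (-1) ^ k * s ^ (k ^ 2 + k) * (1 - x * (s ^ 2) ^ k)⁻¹ = ∑' k, g 0 k :=
    tsum_congr fun k => by simp [hg]
  rw [h0]
  change ∑' k, g b k = _
  induction b using Int.induction_on with
  | zero => simp
  | succ n ih => rw [hstep, ih, zpow_add_one₀ hx0]; ring
  | pred n ih =>
    have h := hstep (-n - 1)
    rw [sub_add_cancel, ih] at h
    rw [zpow_sub_one₀ hx0]
    field_simp
    linear_combination -h

/-! ### The theta series `altTheta` and sums weighted by it -/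

/-- The theta series `∑_b (-1)^b q^{4 b² + u b}`. -/
def altTheta (q : ℂ) (u : ℤ) : ℂ := ∑' b : ℤ, (-1) ^ b * q ^ (4 * b ^ 2 + u * b)

theorem summable_altTheta {q : ℂ} (hq0 : q ≠ 0) (hq1 : ‖q‖ < 1) (u : ℤ) :
    Summable fun b : ℤ => (-1) ^ b * q ^ (4 * b ^ 2 + u * b) := by
  have h := summable_int_zpow_mul hq0 hq1 (e := fun b => 4 * b ^ 2 + u * b) ((|u| + 1) ^ 2)
    (fun b => by
      have h1 := neg_abs_le (u * b)
      rw [abs_mul] at h1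
      nlinarith [sq_abs b, sq_nonneg (2 * |b| - (|u| + 1)), abs_nonneg b, abs_nonneg u])
    (exists_norm_negOnePow_le fun b => b)
  exact h.congr fun b => by ring

theorem altTheta_neg (q : ℂ) (u : ℤ) : altTheta q (-u) = altTheta q u := by
  rw [altTheta, ← (Equiv.neg ℤ).tsum_eq]
  refine tsum_congr fun b => ?_
  simp only [Equiv.neg_apply]
  rw [zpow_neg, ← inv_zpow, show (-1 : ℂ)⁻¹ = -1 by norm_num]
  congr 2
  ring

theorem altTheta_add_eight_mul {q : ℂ} (hq0 : q ≠ 0) (u l : ℤ) :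
    altTheta q (u + 8 * l) = (-1) ^ l * q ^ (-4 * l ^ 2 - u * l) * altTheta q u := by
  rw [altTheta, altTheta, ← tsum_mul_left, ← (Equiv.addRight l).tsum_eq fun b : ℤ =>
    (-1) ^ l * q ^ (-4 * l ^ 2 - u * l) * ((-1) ^ b * q ^ (4 * b ^ 2 + u * b))]
  refine tsum_congr fun b => ?_
  have e : q ^ (4 * b ^ 2 + (u + 8 * l) * b)
      = q ^ (-4 * l ^ 2 - u * l) * q ^ (4 * (b + l) ^ 2 + u * (b + l)) := by
    rw [← zpow_add₀ hq0]; congr 1; ring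
  have h : (-1 : ℂ) ^ l * (-1) ^ l = 1 := by
    rw [← mul_zpow]; norm_num
  rw [Equiv.coe_addRight, e, zpow_add₀ (show (-1 : ℂ) ≠ 0 by norm_num) b l]
  linear_combination (-(-1) ^ b * (q ^ (-4 * l ^ 2 - u * l) *
    q ^ (4 * (b + l) ^ 2 + u * (b + l)))) * h

/-- Evenness in u and the quasi-period 8, applied at u = -4, give the value equal to its own
negative. -/
theorem altTheta_four {q : ℂ} (hq0 : q ≠ 0) : altTheta q 4 = 0 := by
  have h := altTheta_add_eight_mul hq0 (-4) 1
  rw [altTheta_neg] at h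
  norm_num at h
  linear_combination (1 / 2) * h

/-- The form k² - 2kb + 4b² is positive definite, so it outgrows the linear terms. -/
theorem summable_theta_double {q : ℂ} (hq0 : q ≠ 0) (hq1 : ‖q‖ < 1) (u : ℤ) {w : ℤ × ℤ → ℂ}
    (hw : ∃ C, ∀ y, ‖w y‖ ≤ C) :
    Summable fun y : ℤ × ℤ => q ^ (y.1 ^ 2 - y.1) * q ^ (4 * y.2 ^ 2 + (u - 2 * y.1) * y.2) * w y := by
  have h := summable_int_prod_zpow_mul hq0 hq1
    (e := fun y => y.1 ^ 2 - y.1 + (4 * y.2 ^ 2 + (u - 2 * y.1) * y.2)) (2 + (|u| + 1) ^ 2)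
    (fun y => by
      have h1 := neg_abs_le (u * y.2)
      rw [abs_mul] at h1
      have h2 := le_abs_self y.1
      nlinarith [sq_abs y.1, sq_abs y.2, sq_nonneg (y.1 - 2 * y.2), sq_nonneg (|y.1| - 2),
        sq_nonneg (2 * |y.2| - (|u| + 1)), abs_nonneg y.2, abs_nonneg u, sq_nonneg (|u| + 1)]) hw
  exact h.congr fun y => by rw [zpow_add₀ hq0]

theorem summable_altTheta_mul {q : ℂ} (hq0 : q ≠ 0) (hq1 : ‖q‖ < 1) (u : ℤ) {w : ℤ → ℂ}
    (hw : ∃ C, ∀ k, ‖w k‖ ≤ C) :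
    Summable fun k : ℤ => q ^ (k ^ 2 - k) * altTheta q (u - 2 * k) * w k := by
  obtain ⟨C, hC⟩ := hw
  have h := (summable_theta_double hq0 hq1 u (exists_norm_le_mul
    (exists_norm_negOnePow_le fun y : ℤ × ℤ => y.2) ⟨C, fun y : ℤ × ℤ => hC y.1⟩)).prod
  refine h.congr fun k => ?_
  rw [altTheta, ← tsum_mul_left, ← tsum_mul_right]
  exact tsum_congr fun b => by ring

theorem tsum_altTheta_mul_partial_fractions {q : ℂ} (hq0 : q ≠ 0) (hq1 : ‖q‖ < 1) {x : ℂ}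
    (hx0 : x ≠ 0) (hx : ∀ k : ℤ, 1 - x * (q ^ 2) ^ k ≠ 0) (u : ℤ) :
    ∑' k : ℤ, (-1) ^ k * q ^ (k ^ 2 - k) * altTheta q (u - 2 * k) * (1 - x * (q ^ 2) ^ k)⁻¹
      = x * (∑' b : ℤ, (-1) ^ b * q ^ (4 * b ^ 2 + u * b) * x ^ b) *
        ∑' k : ℤ, (-1) ^ k * q ^ (k ^ 2 + k) * (1 - x * (q ^ 2) ^ k)⁻¹ := by
  set F : ℤ → ℤ → ℂ := fun k b => (-1) ^ b * q ^ (4 * b ^ 2 + u * b) *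
    ((-1) ^ k * q ^ (k ^ 2 + k - 2 * k * (b + 1)) * (1 - x * (q ^ 2) ^ k)⁻¹) with hF
  have hsum : Summable (Function.uncurry F) := by
    obtain ⟨C, hC⟩ := exists_norm_inv_one_sub_le x (pow_ne_zero 2 hq0) (norm_sq_lt_one hq1)
    have h := summable_theta_double hq0 hq1 u (exists_norm_le_mul
      (exists_norm_negOnePow_le fun y : ℤ × ℤ => y.2 + y.1) ⟨C, fun y : ℤ × ℤ => hC y.1⟩)
    refine h.congr fun y => ?_
    have e : q ^ (y.1 ^ 2 - y.1) * q ^ (4 * y.2 ^ 2 + (u - 2 * y.1) * y.2)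
        = q ^ (4 * y.2 ^ 2 + u * y.2) * q ^ (y.1 ^ 2 + y.1 - 2 * y.1 * (y.2 + 1)) := by
      rw [← zpow_add₀ hq0, ← zpow_add₀ hq0]; congr 1; ring
    simp only [Function.uncurry, hF]
    rw [e, zpow_add₀ (show (-1 : ℂ) ≠ 0 by norm_num) y.2 y.1]
    ring
  calc _ = ∑' (k : ℤ) (b : ℤ), F k b := by
        refine tsum_congr fun k => ?_
        rw [altTheta, ← tsum_mul_left, ← tsum_mul_right]
        refine tsum_congr fun b => ?_
        have e : q ^ (k ^ 2 - k) * q ^ (4 * b ^ 2 + (u - 2 * k) * b)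
            = q ^ (4 * b ^ 2 + u * b) * q ^ (k ^ 2 + k - 2 * k * (b + 1)) := by
          rw [← zpow_add₀ hq0, ← zpow_add₀ hq0]; congr 1; ring
        simp only [hF]
        linear_combination (-1) ^ k * (-1) ^ b * (1 - x * (q ^ 2) ^ k)⁻¹ * e
    _ = ∑' (b : ℤ) (k : ℤ), F k b := hsum.tsum_comm.symm
    _ = _ := by
        rw [mul_assoc, mul_comm x, ← tsum_mul_right, ← tsum_mul_right]
        refine tsum_congr fun b => ?_
        simp only [hF]
        rw [tsum_mul_left, tsum_partial_fractions_shift hq0 hq1 hx0 hx, zpow_add_one₀ hx0]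
        ring

/-! ### Hecke-type double sums -/

/-- The tail `∑_{r ≥ |j|} c r`. -/
def tailSum (c : ℤ → ℂ) (j : ℤ) : ℂ := ∑' i : ℕ, c (|j| + i)

theorem tailSum_eq_add {c : ℤ → ℂ} (hc : Summable fun i : ℕ => c i) (m : ℕ) :
    tailSum c m = c m + tailSum c (m + 1) := by
  have hs : Summable fun i : ℕ => c (m + i) := by
    have := (summable_nat_add_iff m).2 hc
    simpa [add_comm] using this
  have h : |(m : ℤ) + 1| = m + 1 := abs_of_nonneg (by omega)
  rw [tailSum, tailSum, Nat.abs_cast, hs.tsum_eq_zero_add, h]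
  refine congrArg₂ (· + ·) (by simp) (tsum_congr fun i => ?_)
  push_cast
  congr 1
  ring

theorem tailSum_neg (c : ℤ → ℂ) (j : ℤ) : tailSum c (-j) = tailSum c j := by
  simp [tailSum]

/-- For j < 0 the tails from |j| and |j + 1| differ the other way round; the antisymmetry of c
restores the sign. -/
theorem tailSum_sub_tailSum {c : ℤ → ℂ} (hc : Summable fun i : ℕ => c i)
    (hanti : ∀ r, c (-r - 1) = -c r) (j : ℤ) : tailSum c j - tailSum c (j + 1) = c j := by
  rcases le_or_gt 0 j with h | h
  · lift j to ℕ using h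
    rw [tailSum_eq_add hc]
    ring
  · obtain ⟨m, hm⟩ : ∃ m : ℕ, j = -(m : ℤ) - 1 := ⟨(-j - 1).toNat, by omega⟩
    subst hm
    rw [hanti, sub_add_cancel, tailSum_neg, tailSum_eq_add hc,
      show -(m : ℤ) - 1 = -(m + 1) by ring, tailSum_neg]
    ring

/-! ### A Bailey-type expansion of 1/(-q;q)_{2n+1} and the resulting double sums -/

theorem one_add_pow_ne_zero {q : ℂ} (hq1 : ‖q‖ < 1) (n : ℕ) : 1 + q ^ (n + 1) ≠ 0 := by
  have := one_sub_ne_zero_of_norm_lt (x := -q ^ (n + 1)) (by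
    rw [norm_neg, norm_pow]; exact pow_lt_one₀ (norm_nonneg _) hq1 (by omega))
  rwa [sub_neg_eq_add] at this

theorem summable_mul_recipPoch_add_one (p : ℂ) (n : ℕ) (u : ℤ → ℂ) :
    Summable fun r : ℤ => u r * (recipPoch p (n - r) * recipPoch p (n + r + 1)) :=
  (hasSum_sum_of_ne_finset_zero (s := Finset.Icc (-(n : ℤ) - 1) n) fun r hr => by
    rw [Finset.mem_Icc, not_and_or] at hr
    rcases hr with h | h
    · rw [recipPoch_of_neg p (show (n : ℤ) + r + 1 < 0 by omega), mul_zero, mul_zero]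
    · rw [recipPoch_of_neg p (show (n : ℤ) - r < 0 by omega), zero_mul, mul_zero]).summable

theorem summable_abs_add {c : ℤ → ℂ} (hc : Summable c) (j : ℤ) :
    Summable fun i : ℕ => c (|j| + i) :=
  hc.comp_injective (i := fun i : ℕ => |j| + (i : ℤ)) fun a b h => by simpa using h

/-- The summand of the Bailey pair for `1 / (-q; q)_{2n+1}`. -/
def baileyTerm (q : ℂ) (n : ℕ) (r : ℤ) : ℂ :=
  q ^ (2 * r ^ 2 + r) * (1 - q ^ (2 * r + 1)) *
    (recipPoch (q ^ 2) (n - r) * recipPoch (q ^ 2) (n + r + 1))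

theorem summable_baileyTerm (q : ℂ) (n : ℕ) : Summable (baileyTerm q n) :=
  summable_mul_recipPoch_add_one _ n _

theorem tailSum_baileyTerm_eq_zero (q : ℂ) {n : ℕ} {j : ℤ} (hj : j ∉ Finset.Icc (-(n : ℤ)) n) :
    tailSum (baileyTerm q n) j = 0 := by
  rw [Finset.mem_Icc] at hj
  have h : (n : ℤ) < |j| := by cases abs_cases j <;> omega
  rw [tailSum, ← tsum_zero (β := ℕ)]
  refine tsum_congr fun i => ?_
  rw [baileyTerm, recipPoch_of_neg _ (show (n : ℤ) - (|j| + i) < 0 by omega)]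
  simp

theorem baileyTerm_telescope {q : ℂ} (hq0 : q ≠ 0) (hq1 : ‖q‖ < 1) (n : ℕ) (r : ℤ) :
    (1 + q ^ (2 * n + 2)) * (1 + q ^ (2 * n + 3)) * baileyTerm q (n + 1) r - baileyTerm q n r
      = q ^ (2 * n + 2) * (q ^ (2 * r ^ 2 - r) + q ^ (2 * r ^ 2 + r)) *
          (recipPoch (q ^ 2) ((n + 1 : ℕ) - r) * recipPoch (q ^ 2) ((n + 1 : ℕ) + r))
        - q ^ (2 * n + 2) * (q ^ (2 * (r + 1) ^ 2 - (r + 1)) + q ^ (2 * (r + 1) ^ 2 + (r + 1))) *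
          (recipPoch (q ^ 2) ((n + 1 : ℕ) - (r + 1)) *
            recipPoch (q ^ 2) ((n + 1 : ℕ) + (r + 1))) := by
  have hp := norm_sq_lt_one hq1
  have a1 := recipPoch_eq hp (n - r)
  have b1 := recipPoch_eq hp (n + r + 1)
  simp only [baileyTerm]
  push_cast
  rw [show (n : ℤ) + 1 - (r + 1) = n - r by ring, show (n : ℤ) + 1 + (r + 1) = n + r + 1 + 1 by ring,
    show (n : ℤ) + 1 - r = n - r + 1 by ring, show (n : ℤ) + 1 + r + 1 = n + r + 1 + 1 by ring,
    show (n : ℤ) + 1 + r = n + r + 1 by ring, a1, b1]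
  have e1 : (q ^ 2) ^ ((n : ℤ) - r + 1) = q ^ (2 * n + 2) * (q ^ r)⁻¹ ^ 2 := by
    simp only [← zpow_neg, ← zpow_natCast, ← zpow_mul, ← zpow_add₀ hq0]; congr 1; push_cast; ring
  have e2 : (q ^ 2) ^ ((n : ℤ) + r + 1 + 1) = q ^ (2 * n + 2) * q ^ 2 * (q ^ r) ^ 2 := by
    simp only [← zpow_natCast, ← zpow_mul, ← zpow_add₀ hq0]; congr 1; push_cast; ring
  have e3 : q ^ (2 * r ^ 2 + r) = q ^ (2 * r ^ 2) * q ^ r := zpow_add₀ hq0 _ _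
  have e4 : q ^ (2 * r ^ 2 - r) = q ^ (2 * r ^ 2) * (q ^ r)⁻¹ := by
    rw [← zpow_neg, ← zpow_add₀ hq0]; rfl
  have e5 : q ^ (2 * (r + 1) ^ 2 - (r + 1)) = q ^ (2 * r ^ 2) * (q ^ r) ^ 3 * q := by
    simp only [← zpow_natCast, ← zpow_mul, ← zpow_add₀ hq0, ← zpow_add_one₀ hq0]
    congr 1; push_cast; ring
  have e6 : q ^ (2 * (r + 1) ^ 2 + (r + 1)) = q ^ (2 * r ^ 2) * (q ^ r) ^ 5 * q ^ 3 := by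
    simp only [← zpow_natCast, ← zpow_mul, ← zpow_add₀ hq0]; congr 1; push_cast; ring
  have e7 : q ^ (2 * r + 1) = (q ^ r) ^ 2 * q := by
    simp only [← zpow_natCast, ← zpow_mul, ← zpow_add_one₀ hq0]; congr 1; push_cast; ring
  have e8 : q ^ (2 * n + 3) = q ^ (2 * n + 2) * q := by ring
  have h0 : q ^ r ≠ 0 := zpow_ne_zero _ hq0
  rw [e1, e2, e3, e4, e5, e6, e7, e8]
  generalize q ^ r = y at *
  field_simp
  ring

/-- Induction on n. By `baileyTerm_telescope`, κ times the tail for n + 1 minus the tail for n is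
one boundary term. Weighted by (-1)^j q^{-j²}, the boundary terms sum to finite triple products at x
= 1 and x = q², which vanish. -/
theorem inv_qPoch_eq_tsum_tailSum {q : ℂ} (hq0 : q ≠ 0) (hq1 : ‖q‖ < 1) (n : ℕ) :
    ∑' j : ℤ, (-1) ^ j * q ^ (-j ^ 2) * tailSum (baileyTerm q n) j
      = (qPoch (-q) q (2 * n + 1))⁻¹ := by
  have hq2 : q ^ 2 ≠ 0 := pow_ne_zero 2 hq0
  induction n with
  | zero =>
    rw [tsum_eq_single 0]
    · have h1 : 1 - q ^ 2 ≠ 0 := one_sub_ne_zero_of_norm_lt (norm_sq_lt_one hq1)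
      have h2 : 1 + q ≠ 0 := by simpa using one_add_pow_ne_zero hq1 0
      rw [tailSum, tsum_eq_single 0]
      · have : recipPoch (q ^ 2) 1 = (1 - q ^ 2)⁻¹ := by simp [recipPoch, qPoch]
        simp [baileyTerm, recipPoch_zero, this, qPoch]
        field_simp
        ring
      · intro i hi
        rw [baileyTerm, recipPoch_of_neg _ (show ((0 : ℕ) : ℤ) - (|0| + i) < 0 by simp; omega)]
        simp
    · intro j hj
      rw [tailSum_baileyTerm_eq_zero q (by simpa using hj), mul_zero]
  | succ n ih =>
    set A : ℤ → ℂ := fun r =>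
      recipPoch (q ^ 2) ((n + 1 : ℕ) - r) * recipPoch (q ^ 2) ((n + 1 : ℕ) + r) with hA
    set Γ : ℤ → ℂ := fun r =>
      q ^ (2 * n + 2) * (q ^ (2 * r ^ 2 - r) + q ^ (2 * r ^ 2 + r)) * A r with hΓ
    have hΓsum : Summable Γ := summable_mul_recipPoch _ (n + 1) _
    have hΓneg : ∀ r, Γ (-r) = Γ r := fun r => by
      simp only [hΓ, hA]
      rw [show 2 * (-r) ^ 2 - -r = 2 * r ^ 2 + r by ring,
        show 2 * (-r) ^ 2 + -r = 2 * r ^ 2 - r by ring, sub_neg_eq_add, ← sub_eq_add_neg]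
      ring
    -- The telescoped tail starts at |j|; evenness of Γ removes the absolute value.
    have hΓabs : ∀ r, Γ |r| = Γ r := fun r => by
      rcases abs_choice r with h | h <;> rw [h]
      exact hΓneg r
    set κ : ℂ := (1 + q ^ (2 * n + 2)) * (1 + q ^ (2 * n + 3)) with hκ
    have htail : ∀ j, κ * tailSum (baileyTerm q (n + 1)) j - tailSum (baileyTerm q n) j = Γ j := by
      intro j
      have s1 := summable_abs_add (summable_baileyTerm q (n + 1)) j
      have s2 := summable_abs_add (summable_baileyTerm q n) j
      have s3 := summable_abs_add hΓsum j
      have s4 : Summable fun i : ℕ => Γ (|j| + i + 1) := by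
        simpa [add_assoc] using (summable_nat_add_iff 1).2 s3
      rw [tailSum, tailSum, ← tsum_mul_left, ← Summable.tsum_sub (s1.mul_left _) s2]
      rw [tsum_congr fun i : ℕ => baileyTerm_telescope hq0 hq1 n (|j| + i)]
      change ∑' i : ℕ, (Γ (|j| + i) - Γ (|j| + i + 1)) = Γ j
      rw [Summable.tsum_sub s3 s4, s3.tsum_eq_zero_add]
      simp [hΓabs, add_assoc]
    have hsum : ∀ n, Summable fun j : ℤ => (-1) ^ j * q ^ (-j ^ 2) * tailSum (baileyTerm q n) j :=
      fun n => (hasSum_sum_of_ne_finset_zero (s := Finset.Icc (-(n : ℤ)) n) fun j hj => by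
        rw [tailSum_baileyTerm_eq_zero q hj, mul_zero]).summable
    have key : κ * (∑' j : ℤ, (-1) ^ j * q ^ (-j ^ 2) * tailSum (baileyTerm q (n + 1)) j)
        - ∑' j : ℤ, (-1) ^ j * q ^ (-j ^ 2) * tailSum (baileyTerm q n) j = 0 := by
      have hv : ∀ x, Summable fun r : ℤ => (-1) ^ r * q ^ (r ^ 2 - r) * x ^ r * A r := fun x =>
        summable_mul_recipPoch _ (n + 1) _
      have hv1 : ∑' r : ℤ, (-1) ^ r * q ^ (r ^ 2 - r) * 1 ^ r * A r = 0 := by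
        rw [hA, finite_jacobi_triple_product hq0 hq1 one_ne_zero]
        simp [qPoch, Finset.prod_range_succ']
      have hv2 : ∑' r : ℤ, (-1) ^ r * q ^ (r ^ 2 - r) * (q ^ 2) ^ r * A r = 0 := by
        rw [hA, finite_jacobi_triple_product hq0 hq1 hq2, div_self hq2]
        simp [qPoch, Finset.prod_range_succ']
      rw [← tsum_mul_left, ← Summable.tsum_sub ((hsum _).mul_left _) (hsum _)]
      calc _ = ∑' r : ℤ, q ^ (2 * n + 2) * ((-1) ^ r * q ^ (r ^ 2 - r) * 1 ^ r * A r
            + (-1) ^ r * q ^ (r ^ 2 - r) * (q ^ 2) ^ r * A r) := by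
            refine tsum_congr fun j => ?_
            have h := htail j
            have e1 : q ^ (-j ^ 2) * q ^ (2 * j ^ 2 - j) = q ^ (j ^ 2 - j) := by
              rw [← zpow_add₀ hq0]; congr 1; ring
            have e2 : q ^ (-j ^ 2) * q ^ (2 * j ^ 2 + j) = q ^ (j ^ 2 - j) * (q ^ 2) ^ j := by
              simp only [← zpow_natCast, ← zpow_mul, ← zpow_add₀ hq0]; congr 1; push_cast; ring
            simp only [hΓ] at h
            rw [one_zpow]
            linear_combination (-1) ^ j * q ^ (-j ^ 2) * h
              + (-1) ^ j * q ^ (2 * n + 2) * A j * (e1 + e2)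
        _ = 0 := by
            rw [tsum_mul_left, Summable.tsum_add (hv _) (hv _), hv1, hv2]
            simp
    have n1 : κ ≠ 0 := mul_ne_zero (one_add_pow_ne_zero hq1 _) (one_add_pow_ne_zero hq1 _)
    refine mul_left_cancel₀ n1 ?_
    have hκ' : qPoch (-q) q (2 * (n + 1) + 1) = qPoch (-q) q (2 * n + 1) * κ := by
      rw [show 2 * (n + 1) + 1 = 2 * n + 1 + 1 + 1 by ring, qPoch_succ _ _ (2 * n + 1 + 1),
        qPoch_succ _ _ (2 * n + 1), hκ]
      ring
    rw [sub_eq_zero.1 key, ih, hκ', mul_inv, mul_left_comm, mul_inv_cancel₀ n1, mul_one]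

theorem tsum_tailSum_comm {q : ℂ} (hq0 : q ≠ 0) (hq1 : ‖q‖ < 1) {d : ℕ → ℤ → ℂ} {e : ℤ → ℂ} {C : ℝ}
    (hd : ∀ n r : ℕ, ‖d n r‖ ≤ C * ‖q‖ ^ (2 * r ^ 2 + n))
    (he : ∀ r : ℕ, ∑' n, d n r = e r) :
    ∑' n, ∑' j : ℤ, (-1) ^ j * q ^ (-j ^ 2) * tailSum (d n) j
      = ∑' j : ℤ, (-1) ^ j * q ^ (-j ^ 2) * tailSum e j := by
  have hq : 0 < ‖q‖ := norm_pos_iff.2 hq0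
  have hC : 0 ≤ C := by simpa using (norm_nonneg _).trans (hd 0 0)
  have hgeo := summable_geometric_of_lt_one (norm_nonneg q) hq1
  have hsum : Summable (Function.uncurry fun (n : ℕ) (x : ℤ × ℕ) =>
      (-1) ^ x.1 * q ^ (-x.1 ^ 2) * d n (|x.1| + x.2)) := by
    have hw : Summable fun y : ℕ × (ℤ × ℕ) => ‖q‖ ^ (y.1 + (y.2.1.natAbs + y.2.2)) :=
      summable_pow_add (v := id) (w := fun x : ℤ × ℕ => x.1.natAbs + x.2) (norm_nonneg q) hgeo
        (summable_pow_add (v := Int.natAbs) (w := id) (norm_nonneg q)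
          (summable_pow_natAbs (norm_nonneg q) hq1) hgeo)
    refine Summable.of_norm_bounded (hw.mul_left C) ?_
    rintro ⟨n, j, i⟩
    simp only [Function.uncurry]
    have h1 := hd n (j.natAbs + i)
    rw [Nat.cast_add, Int.natCast_natAbs] at h1
    rw [norm_mul, norm_mul, norm_negOnePow, one_mul, norm_zpow]
    calc ‖q‖ ^ (-j ^ 2) * ‖d n (|j| + i)‖
        ≤ ‖q‖ ^ (-j ^ 2) * (C * ‖q‖ ^ (2 * (j.natAbs + i) ^ 2 + n)) := by gcongr
      _ = C * ‖q‖ ^ (-j ^ 2 + (2 * (j.natAbs + i) ^ 2 + n : ℕ)) := by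
          rw [zpow_add₀ hq.ne', zpow_natCast]; ring
      _ ≤ C * ‖q‖ ^ (n + (j.natAbs + i)) := by
          rw [← zpow_natCast ‖q‖ (n + (j.natAbs + i))]
          -- Since r = |j| + i, the decay 2r² outweighs -j²: the difference j² + 4|j|i + 2i² is at
          -- least |j| + i.
          refine mul_le_mul_of_nonneg_left (zpow_le_zpow_right_of_le_one₀ hq hq1.le ?_) hC
          push_cast
          nlinarith [sq_abs j, Int.le_self_sq |j|, Int.le_self_sq (i : ℤ), abs_nonneg j,
            mul_nonneg (abs_nonneg j) (Int.natCast_nonneg i)]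
  calc _ = ∑' (n : ℕ) (x : ℤ × ℕ), (-1) ^ x.1 * q ^ (-x.1 ^ 2) * d n (|x.1| + x.2) := by
        refine tsum_congr fun n => ?_
        have hn : Summable fun x : ℤ × ℕ => (-1) ^ x.1 * q ^ (-x.1 ^ 2) * d n (|x.1| + x.2) :=
          hsum.prod_factor n
        rw [hn.tsum_prod]
        exact tsum_congr fun j => by simp only [tailSum]; rw [tsum_mul_left]
    _ = ∑' (x : ℤ × ℕ) (n : ℕ), (-1) ^ x.1 * q ^ (-x.1 ^ 2) * d n (|x.1| + x.2) :=
        hsum.tsum_comm.symm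
    _ = _ := by
        have h := hsum.prod_symm.prod
        simp only [Prod.swap, Function.uncurry] at h
        rw [h.tsum_prod]
        refine tsum_congr fun j => ?_
        simp only [tailSum]
        rw [← tsum_mul_left]
        refine tsum_congr fun i => ?_
        rw [tsum_mul_left, ← Int.natCast_natAbs, ← Nat.cast_add, he]

theorem norm_one_sub_pow_le {q : ℂ} (hq1 : ‖q‖ < 1) (n : ℕ) : ‖1 - q ^ n‖ ≤ 2 := by
  refine (norm_sub_le _ _).trans ?_
  rw [norm_one, norm_pow]
  linarith [pow_le_one₀ (norm_nonneg q) hq1.le (n := n)]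

theorem qPochInf_mul_psiBar₁ {q : ℂ} (hq0 : q ≠ 0) (hq1 : ‖q‖ < 1) :
    qPochInf (q ^ 2) (q ^ 2) * psiBar₁ q
      = ∑' j : ℤ, (-1) ^ j * q ^ (-j ^ 2) *
          tailSum (fun r => q ^ (4 * r ^ 2 + 3 * r) - q ^ (4 * r ^ 2 + 5 * r + 1)) j := by
  have hp := norm_sq_lt_one hq1
  have hP := qPochInf_ne_zero_of_norm_lt hp hp
  obtain ⟨C, hC⟩ := exists_norm_recipPoch_le hp
  have hC0 : 0 ≤ C := (norm_nonneg _).trans (hC 0)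
  rw [psiBar₁, ← tsum_mul_left]
  rw [← tsum_tailSum_comm hq0 hq1 (C := ‖qPochInf (q ^ 2) (q ^ 2)‖ * (2 * (C * C)))
    (d := fun n r => qPochInf (q ^ 2) (q ^ 2) * (q ^ (2 * n ^ 2 + 2 * n) * baileyTerm q n r))]
  · refine tsum_congr fun n => ?_
    rw [div_eq_mul_inv, ← inv_qPoch_eq_tsum_tailSum hq0 hq1, ← tsum_mul_left, ← tsum_mul_left]
    refine tsum_congr fun j => ?_
    simp only [tailSum, tsum_mul_left]
    ring
  · intro n r
    have e1 : q ^ (2 * (r : ℤ) ^ 2 + r) = q ^ (2 * r ^ 2 + r) := by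
      rw [← zpow_natCast]; push_cast; rfl
    have e2 : q ^ (2 * (r : ℤ) + 1) = q ^ (2 * r + 1) := by
      rw [← zpow_natCast]; push_cast; rfl
    have h1 : ‖q ^ (2 * n ^ 2 + 2 * n) * q ^ (2 * r ^ 2 + r)‖ ≤ ‖q‖ ^ (2 * r ^ 2 + n) := by
      rw [← pow_add, norm_pow]
      exact pow_le_pow_of_le_one (norm_nonneg _) hq1.le (by nlinarith)
    rw [baileyTerm, e1, e2, norm_mul, mul_assoc ‖_‖,
      show q ^ (2 * n ^ 2 + 2 * n) * (q ^ (2 * r ^ 2 + r) * (1 - q ^ (2 * r + 1)) *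
        (recipPoch (q ^ 2) (n - r) * recipPoch (q ^ 2) (n + r + 1)))
      = (q ^ (2 * n ^ 2 + 2 * n) * q ^ (2 * r ^ 2 + r)) * (1 - q ^ (2 * r + 1)) *
        (recipPoch (q ^ 2) (n - r) * recipPoch (q ^ 2) (n + r + 1)) by ring, norm_mul,
      norm_mul _ (1 - _), norm_mul (recipPoch _ _)]
    refine mul_le_mul_of_nonneg_left ?_ (norm_nonneg _)
    calc _ ≤ ‖q‖ ^ (2 * r ^ 2 + n) * 2 * (C * C) := by
          gcongr
          exacts [norm_one_sub_pow_le hq1 _, hC _, hC _]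
      _ = _ := by ring
  · intro r
    have h := tsum_sq_mul_recipPoch_nat hp 1 r
    have e0 : ∀ n : ℕ, q ^ (2 * n ^ 2 + 2 * n) = (q ^ 2) ^ (n ^ 2 + 1 * n) := fun n => by ring
    calc _ = qPochInf (q ^ 2) (q ^ 2) * (q ^ (2 * (r : ℤ) ^ 2 + r) * (1 - q ^ (2 * (r : ℤ) + 1))) *
          ∑' n : ℕ, (q ^ 2) ^ (n ^ 2 + 1 * n) *
            (recipPoch (q ^ 2) (n - r) * recipPoch (q ^ 2) (n + r + (1 : ℕ))) := by
          rw [← tsum_mul_left]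
          refine tsum_congr fun n => ?_
          rw [e0, baileyTerm]
          push_cast
          ring
      _ = _ := by
          rw [h]
          have e1 : q ^ (4 * (r : ℤ) ^ 2 + 3 * r)
              = q ^ (2 * (r : ℤ) ^ 2 + r) * (q ^ 2) ^ (r ^ 2 + 1 * r) := by
            simp only [← zpow_natCast, ← zpow_mul, ← zpow_add₀ hq0]; congr 1; push_cast; ring
          have e2 : q ^ (4 * (r : ℤ) ^ 2 + 5 * r + 1)
              = q ^ (2 * (r : ℤ) ^ 2 + r) * q ^ (2 * (r : ℤ) + 1) * (q ^ 2) ^ (r ^ 2 + 1 * r) := by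
            simp only [← zpow_natCast, ← zpow_mul, ← zpow_add₀ hq0]; congr 1; push_cast; ring
          rw [e1, e2]
          field_simp

/-- The factor 1 + q^{2n+1} passes from (-q;q)_{2n+1} to (-q;q)_{2n}. It splits the term into two of
the symmetric shape n ∓ r, at r and r + 1, to which Cauchy's identity with ε = 0 applies. -/
theorem one_add_pow_mul_baileyTerm {q : ℂ} (hq0 : q ≠ 0) (hq1 : ‖q‖ < 1) (n : ℕ) (r : ℤ) :
    (1 + q ^ (2 * n + 1)) * baileyTerm q n r
      = q ^ (2 * r ^ 2 + r) * (recipPoch (q ^ 2) (n - r) * recipPoch (q ^ 2) (n + r))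
        - q ^ (2 * r ^ 2 + r) * q ^ (2 * r + 1) *
          (recipPoch (q ^ 2) (n - (r + 1)) * recipPoch (q ^ 2) (n + (r + 1))) := by
  have hp := norm_sq_lt_one hq1
  have a1 := recipPoch_eq hp (n - (r + 1))
  have b1 := recipPoch_eq hp (n + r)
  rw [show (n : ℤ) - (r + 1) + 1 = n - r by ring] at a1
  rw [a1, b1, baileyTerm, ← add_assoc]
  have e1 : (q ^ 2) ^ ((n : ℤ) - r) = q ^ (2 * n + 1) * (q ^ (2 * r + 1))⁻¹ := by
    simp only [← zpow_neg, ← zpow_natCast, ← zpow_mul, ← zpow_add₀ hq0]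
    congr 1; push_cast; ring
  have e2 : (q ^ 2) ^ ((n : ℤ) + r + 1) = q ^ (2 * n + 1) * q ^ (2 * r + 1) := by
    simp only [← zpow_natCast, ← zpow_mul, ← zpow_add₀ hq0]; congr 1; push_cast; ring
  have h0 : q ^ (2 * r + 1) ≠ 0 := zpow_ne_zero _ hq0
  rw [e1, e2]
  generalize q ^ (2 * r + 1) = y at *
  field_simp
  ring

theorem qPochInf_mul_psiBar₀ {q : ℂ} (hq0 : q ≠ 0) (hq1 : ‖q‖ < 1) :
    qPochInf (q ^ 2) (q ^ 2) * psiBar₀ q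
      = ∑' j : ℤ, (-1) ^ j * q ^ (-j ^ 2) *
          tailSum (fun r => q ^ (4 * r ^ 2 + r) - q ^ (4 * r ^ 2 + 7 * r + 3)) j := by
  have hp := norm_sq_lt_one hq1
  have hP := qPochInf_ne_zero_of_norm_lt hp hp
  obtain ⟨C, hC⟩ := exists_norm_recipPoch_le hp
  have hC0 : 0 ≤ C := (norm_nonneg _).trans (hC 0)
  rw [psiBar₀, ← tsum_mul_left]
  rw [← tsum_tailSum_comm hq0 hq1 (C := ‖qPochInf (q ^ 2) (q ^ 2)‖ * (2 * (2 * (C * C))))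
    (d := fun n r => qPochInf (q ^ 2) (q ^ 2) *
      (q ^ (2 * n ^ 2) * ((1 + q ^ (2 * n + 1)) * baileyTerm q n r)))]
  · refine tsum_congr fun n => ?_
    have h0 : qPoch (-q) q (2 * n + 1) = qPoch (-q) q (2 * n) * (1 + q ^ (2 * n + 1)) := by
      rw [qPoch_succ]; ring
    have h1 := inv_qPoch_eq_tsum_tailSum hq0 hq1 n
    have h2 := one_add_pow_ne_zero hq1 (2 * n)
    have h3 : (qPoch (-q) q (2 * n))⁻¹
        = (1 + q ^ (2 * n + 1)) * (qPoch (-q) q (2 * n + 1))⁻¹ := by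
      rw [h0, mul_inv]; field_simp
    rw [div_eq_mul_inv, h3, ← h1, ← tsum_mul_left, ← tsum_mul_left, ← tsum_mul_left]
    refine tsum_congr fun j => ?_
    simp only [tailSum, tsum_mul_left]
    ring
  · intro n r
    have e1 : q ^ (2 * (r : ℤ) ^ 2 + r) = q ^ (2 * r ^ 2 + r) := by
      rw [← zpow_natCast]; push_cast; rfl
    have e2 : q ^ (2 * (r : ℤ) + 1) = q ^ (2 * r + 1) := by
      rw [← zpow_natCast]; push_cast; rfl
    have h1 : ‖q ^ (2 * n ^ 2) * q ^ (2 * r ^ 2 + r)‖ ≤ ‖q‖ ^ (2 * r ^ 2 + n) := by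
      rw [← pow_add, norm_pow]
      exact pow_le_pow_of_le_one (norm_nonneg _) hq1.le (by nlinarith)
    have h2 : ‖1 + q ^ (2 * n + 1)‖ ≤ 2 := by
      refine (norm_add_le _ _).trans ?_
      rw [norm_one, norm_pow]
      linarith [pow_le_one₀ (norm_nonneg q) hq1.le (n := 2 * n + 1)]
    rw [baileyTerm, e1, e2, norm_mul, mul_assoc ‖_‖,
      show q ^ (2 * n ^ 2) * ((1 + q ^ (2 * n + 1)) * (q ^ (2 * r ^ 2 + r) * (1 - q ^ (2 * r + 1)) *
        (recipPoch (q ^ 2) (n - r) * recipPoch (q ^ 2) (n + r + 1))))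
      = (q ^ (2 * n ^ 2) * q ^ (2 * r ^ 2 + r)) * (1 + q ^ (2 * n + 1)) * (1 - q ^ (2 * r + 1)) *
        (recipPoch (q ^ 2) (n - r) * recipPoch (q ^ 2) (n + r + 1)) by ring, norm_mul,
      norm_mul _ (1 - _), norm_mul _ (1 + _), norm_mul (recipPoch _ _)]
    refine mul_le_mul_of_nonneg_left ?_ (norm_nonneg _)
    calc _ ≤ ‖q‖ ^ (2 * r ^ 2 + n) * 2 * 2 * (C * C) := by
          gcongr
          exacts [norm_one_sub_pow_le hq1 _, hC _, hC _]
      _ = _ := by ring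
  · intro r
    have hs : ∀ r : ℤ, Summable fun n : ℕ =>
        (q ^ 2) ^ (n ^ 2) * (recipPoch (q ^ 2) (n - r) * recipPoch (q ^ 2) (n + r)) := by
      intro r
      refine Summable.of_norm_bounded
        ((summable_geometric_of_lt_one (norm_nonneg _) hp).mul_right (C * C)) fun n => ?_
      rw [norm_mul, norm_mul]
      gcongr
      · simpa using norm_pow_sq_add_le hp 0 n
      · exact hC _
      · exact hC _
    calc _ = qPochInf (q ^ 2) (q ^ 2) * (q ^ (2 * (r : ℤ) ^ 2 + r) *
            (∑' n : ℕ, (q ^ 2) ^ (n ^ 2) *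
              (recipPoch (q ^ 2) (n - r) * recipPoch (q ^ 2) (n + r)))
          - q ^ (2 * (r : ℤ) ^ 2 + r) * q ^ (2 * (r : ℤ) + 1) * ∑' n : ℕ, (q ^ 2) ^ (n ^ 2) *
            (recipPoch (q ^ 2) (n - (r + 1)) * recipPoch (q ^ 2) (n + (r + 1)))) := by
          rw [← tsum_mul_left, ← tsum_mul_left, ← Summable.tsum_sub ((hs _).mul_left _)
            ((hs _).mul_left _), ← tsum_mul_left]
          refine tsum_congr fun n => ?_
          rw [one_add_pow_mul_baileyTerm hq0 hq1]
          ring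
      _ = _ := by
          rw [tsum_sq_mul_recipPoch hp, tsum_sq_mul_recipPoch hp]
          have e1 : q ^ (4 * (r : ℤ) ^ 2 + r)
              = q ^ (2 * (r : ℤ) ^ 2 + r) * (q ^ 2) ^ ((r : ℤ) ^ 2) := by
            simp only [← zpow_natCast, ← zpow_mul, ← zpow_add₀ hq0]; congr 1; push_cast; ring
          have e2 : q ^ (4 * (r : ℤ) ^ 2 + 7 * r + 3)
              = q ^ (2 * (r : ℤ) ^ 2 + r) * q ^ (2 * (r : ℤ) + 1) *
                (q ^ 2) ^ (((r : ℤ) + 1) ^ 2) := by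
            simp only [← zpow_natCast, ← zpow_mul, ← zpow_add₀ hq0]; congr 1; push_cast; ring
          rw [e1, e2]
          field_simp

/-! ### From Hecke-type double sums to Lambert-type series -/

theorem one_add_zpow_ne_zero {q : ℂ} (hq1 : ‖q‖ < 1) {m : ℤ} (hm : m ≠ 0) :
    1 + q ^ m ≠ 0 := by
  intro h
  have h1 : ‖q‖ ^ m = 1 := by
    rw [← norm_zpow, show q ^ m = -1 by linear_combination h, norm_neg, norm_one]
  exact hm ((zpow_eq_one_iff_right₀ (norm_nonneg q) hq1.ne).1 h1)

theorem norm_tailSum_le {q : ℂ} (hq1 : ‖q‖ < 1) {c : ℤ → ℂ} {C : ℝ}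
    (hb : ∀ r : ℕ, ‖c r‖ ≤ C * ‖q‖ ^ (4 * r ^ 2)) (j : ℤ) :
    ‖tailSum c j‖ ≤ C * ‖q‖ ^ (4 * j.natAbs ^ 2) * (1 - ‖q‖)⁻¹ := by
  have hC : 0 ≤ C := by simpa using (norm_nonneg _).trans (hb 0)
  refine tsum_of_norm_bounded ((hasSum_geometric_of_lt_one (norm_nonneg q) hq1).mul_left _)
    fun i => ?_
  rw [← Int.natCast_natAbs, ← Nat.cast_add]
  refine (hb _).trans ?_
  rw [mul_assoc, ← pow_add]
  exact mul_le_mul_of_nonneg_left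
    (pow_le_pow_of_le_one (norm_nonneg _) hq1.le
      (by nlinarith [Nat.zero_le (j.natAbs * i), Nat.le_self_pow two_ne_zero i])) hC

theorem summable_tailSum {q : ℂ} (hq0 : q ≠ 0) (hq1 : ‖q‖ < 1) {c : ℤ → ℂ} {C : ℝ}
    (hb : ∀ r : ℕ, ‖c r‖ ≤ C * ‖q‖ ^ (4 * r ^ 2)) :
    Summable fun j : ℤ => (-1) ^ j * q ^ (-j ^ 2) * tailSum c j := by
  have hq : 0 < ‖q‖ := norm_pos_iff.2 hq0
  -- The tail is O(|q|^{4j²}), which leaves 3j² after the factor q^{-j²}.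
  have h := summable_int_zpow_mul hq0 hq1 (e := fun j => 3 * j ^ 2) 0
    (fun j => by nlinarith [sq_abs j, Int.le_self_sq |j|])
    (u := fun j => (-1) ^ j * (q ^ (-4 * j ^ 2) * tailSum c j)) ⟨C * (1 - ‖q‖)⁻¹, fun j => by
      rw [norm_mul, norm_negOnePow, one_mul, norm_mul, norm_zpow]
      calc _ ≤ ‖q‖ ^ (-4 * j ^ 2) * (C * ‖q‖ ^ (4 * j.natAbs ^ 2) * (1 - ‖q‖)⁻¹) := by
            gcongr
            exact norm_tailSum_le hq1 hb j
        _ = (‖q‖ ^ (-4 * j ^ 2) * ‖q‖ ^ (4 * j.natAbs ^ 2)) * (C * (1 - ‖q‖)⁻¹) := by ring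
        _ = _ := by
            rw [← zpow_natCast, ← zpow_add₀ hq.ne']
            push_cast
            rw [sq_abs, show -4 * j ^ 2 + 4 * j ^ 2 = 0 by ring, zpow_zero, one_mul]⟩
  refine h.congr fun j => ?_
  have e : q ^ (-j ^ 2) = q ^ (3 * j ^ 2) * q ^ (-4 * j ^ 2) := by
    rw [← zpow_add₀ hq0]; congr 1; ring
  rw [e]
  ring

theorem summable_zpow_sq_sub {q : ℂ} (hq0 : q ≠ 0) (hq1 : ‖q‖ < 1) :
    Summable fun a : ℤ => q ^ (a ^ 2 - a) := by
  have h := summable_int_zpow_mul hq0 hq1 (e := fun a => a ^ 2 - a) 1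
    (fun a => by cases abs_cases a <;> nlinarith [sq_nonneg (a - 1)])
    (u := fun _ => 1) ⟨1, fun _ => by simp⟩
  simpa using h

theorem summable_and_tsum_mul_tsum_int {f h : ℤ → ℂ} (hf : Summable f) (hh : Summable h) :
    (∀ k, Summable fun a => f a * h (k - a)) ∧
      (∑' a, f a) * ∑' j, h j = ∑' k, ∑' a, f a * h (k - a) := by
  let e : ℤ × ℤ ≃ ℤ × ℤ :=
    ⟨fun y => (y.2, y.1 - y.2), fun y => (y.1 + y.2, y.1), fun y => by simp, fun y => by simp⟩
  have hprod : Summable fun y : ℤ × ℤ => f y.1 * h y.2 :=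
    summable_mul_of_summable_norm hf.norm hh.norm
  have hprod' : Summable fun y : ℤ × ℤ => f y.2 * h (y.1 - y.2) := e.summable_iff.2 hprod
  refine ⟨fun k => hprod'.prod_factor k, ?_⟩
  rw [tsum_mul_tsum_of_summable_norm hf.norm hh.norm, ← hprod'.tsum_prod]
  exact (e.tsum_eq fun y : ℤ × ℤ => f y.1 * h y.2).symm

theorem tsum_mul_tsum_tailSum {q : ℂ} (hq0 : q ≠ 0) (hq1 : ‖q‖ < 1) {c : ℤ → ℂ} {C : ℝ}
    (hb : ∀ r : ℕ, ‖c r‖ ≤ C * ‖q‖ ^ (4 * r ^ 2)) (hanti : ∀ r, c (-r - 1) = -c r) :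
    (∑' a : ℤ, q ^ (a ^ 2 - a)) * ∑' j : ℤ, (-1) ^ j * q ^ (-j ^ 2) * tailSum c j
      = ∑' k : ℤ, q ^ (k ^ 2 - k) * (∑' b : ℤ, (-1) ^ b * q ^ (b - 2 * k * b) * c b) *
          (1 + q ^ (2 * k - 1))⁻¹ := by
  have hC : 0 ≤ C := by simpa using (norm_nonneg _).trans (hb 0)
  have hcsum : Summable fun i : ℕ => c i := by
    refine Summable.of_norm_bounded
      ((summable_geometric_of_lt_one (norm_nonneg q) hq1).mul_left C) fun i => (hb i).trans ?_
    exact mul_le_mul_of_nonneg_left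
      (pow_le_pow_of_le_one (norm_nonneg _) hq1.le (by nlinarith)) hC
  set h : ℤ → ℂ := fun j => (-1) ^ j * q ^ (-j ^ 2) * tailSum c j with hh
  set θ : ℤ → ℂ := fun a => q ^ (a ^ 2 - a) with hθ
  have hhs : Summable h := summable_tailSum hq0 hq1 hb
  have hθs : Summable θ := summable_zpow_sq_sub hq0 hq1
  obtain ⟨hW, hmul⟩ := summable_and_tsum_mul_tsum_int hθs hhs
  rw [hmul]
  refine tsum_congr fun k => ?_
  rw [eq_mul_inv_iff_mul_eq₀ (one_add_zpow_ne_zero hq1 (by omega)), mul_comm, add_mul, one_mul]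
  have hshift : q ^ (2 * k - 1) * ∑' a, θ a * h (k - a)
      = ∑' a, q ^ (2 * k - 1) * (θ (a - 1) * h (k - (a - 1))) := by
    rw [tsum_mul_left]
    exact congrArg _ ((Equiv.subRight (1 : ℤ)).tsum_eq fun a => θ a * h (k - a)).symm
  have hWshift : Summable fun a => θ (a - 1) * h (k - (a - 1)) :=
    (Equiv.subRight (1 : ℤ)).summable_iff.2 (hW k)
  -- The factor q^{2k-1} makes the Gaussian exponents at a and a - 1 agree, while (-1)^j changes
  -- sign; the two tails at k - a and k - a + 1 thus collapse to c (k - a).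
  have hterm : ∀ a, θ a * h (k - a) + q ^ (2 * k - 1) * (θ (a - 1) * h (k - (a - 1)))
      = θ a * ((-1) ^ (k - a) * q ^ (-(k - a) ^ 2) * c (k - a)) := by
    intro a
    have h1 := tailSum_sub_tailSum hcsum hanti (k - a)
    have e1 : q ^ (2 * k - 1) * q ^ ((a - 1) ^ 2 - (a - 1)) * q ^ (-(k - a + 1) ^ 2)
        = q ^ (a ^ 2 - a) * q ^ (-(k - a) ^ 2) := by
      simp only [← zpow_add₀ hq0]; congr 1; ring
    simp only [hθ, hh]
    rw [show k - (a - 1) = k - a + 1 by ring, zpow_add_one₀ (by norm_num), ← h1]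
    linear_combination (-(-1) ^ (k - a) * tailSum c (k - a + 1)) * e1
  rw [hshift, ← Summable.tsum_add (hW k) (hWshift.mul_left _), tsum_congr hterm,
    ← (Equiv.subLeft k).tsum_eq, ← tsum_mul_left]
  refine tsum_congr fun b => ?_
  have e1 : q ^ ((k - b) ^ 2 - (k - b)) * q ^ (-b ^ 2) = q ^ (k ^ 2 - k) * q ^ (b - 2 * k * b) := by
    simp only [← zpow_add₀ hq0]; congr 1; ring
  simp only [Equiv.subLeft_apply, hθ, sub_sub_cancel]
  linear_combination ((-1) ^ b * c b) * e1

/-! ### Infinite product identities -/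

theorem qPochInf_eq_mul {p : ℂ} (hp : ‖p‖ < 1) (x : ℂ) :
    qPochInf x p = (1 - x) * qPochInf (p * x) p := by
  have h1 := (tendsto_qPoch x hp).comp (tendsto_add_atTop_nat 1)
  refine tendsto_nhds_unique h1 (((tendsto_qPoch (p * x) hp).const_mul (1 - x)).congr fun n => ?_)
  simp only [Function.comp, qPoch, Finset.prod_range_succ' _ n, pow_zero, one_mul]
  rw [mul_comm]
  refine congrArg₂ (· * ·) (Finset.prod_congr rfl fun i _ => ?_) rfl
  ring

theorem qPochInf_mul_neg {p : ℂ} (hp : ‖p‖ < 1) (x : ℂ) :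
    qPochInf x p * qPochInf (-x) p = qPochInf (x ^ 2) (p ^ 2) := by
  refine tendsto_nhds_unique ((tendsto_qPoch x hp).mul (tendsto_qPoch (-x) hp))
    ((tendsto_qPoch (x ^ 2) (norm_sq_lt_one hp)).congr fun n => ?_)
  rw [qPoch, qPoch, qPoch, ← Finset.prod_mul_distrib]
  exact Finset.prod_congr rfl fun i _ => by ring

theorem qPochInf_even_mul_odd {p : ℂ} (hp : ‖p‖ < 1) (x : ℂ) :
    qPochInf x (p ^ 2) * qPochInf (p * x) (p ^ 2) = qPochInf x p := by
  have hp2 := norm_sq_lt_one hp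
  have h1 := (tendsto_qPoch x hp).comp (tendsto_atTop_mono (fun n : ℕ => (by omega : n ≤ 2 * n))
    tendsto_id)
  refine tendsto_nhds_unique
    (((tendsto_qPoch x hp2).mul (tendsto_qPoch (p * x) hp2)).congr fun n => ?_) h1
  simp only [Function.comp]
  induction n with
  | zero => simp [qPoch]
  | succ n ih =>
    rw [show 2 * (n + 1) = 2 * n + 1 + 1 by ring, qPoch_succ, qPoch_succ, qPoch_succ _ _ (2 * n + 1),
      qPoch_succ _ _ (2 * n), ← ih]
    ring

theorem theta_symm {x p : ℂ} (hp : p ≠ 0) : theta (p / x) p = theta x p := by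
  rw [theta, theta, div_div_cancel₀ hp]
  ring

theorem theta_neg_one {p : ℂ} (hp : ‖p‖ < 1) :
    theta (-1) p = 2 * qPochInf (-p) p ^ 2 * qPochInf p p := by
  rw [theta, qPochInf_eq_mul hp, div_neg, div_one, mul_neg_one]
  ring

theorem theta_half {q : ℂ} (hq0 : q ≠ 0) :
    theta q (q ^ 2) = qPochInf q (q ^ 2) ^ 2 * qPochInf (q ^ 2) (q ^ 2) := by
  rw [theta, show q ^ 2 / q = q by field_simp]
  ring

theorem theta_neg_half {q : ℂ} (hq0 : q ≠ 0) :
    theta (-q) (q ^ 2) = qPochInf (-q) (q ^ 2) ^ 2 * qPochInf (q ^ 2) (q ^ 2) := by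
  rw [theta, show q ^ 2 / -q = -q by field_simp]
  ring

theorem qPochInf_neg_sq_mul {q : ℂ} (hq1 : ‖q‖ < 1) :
    qPochInf (-q ^ 2) (q ^ 2) * qPochInf (q ^ 2) (q ^ 2) = qPochInf (q ^ 4) (q ^ 4) := by
  rw [mul_comm, qPochInf_mul_neg (norm_sq_lt_one hq1)]
  congr 1 <;> ring

theorem euler_product {q : ℂ} (hq1 : ‖q‖ < 1) :
    qPochInf (-q ^ 2) (q ^ 2) * qPochInf q (q ^ 2) * qPochInf (-q) (q ^ 2) = 1 := by
  have hp := norm_sq_lt_one hq1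
  have h1 := qPochInf_mul_neg hp q
  have h2 := qPochInf_even_mul_odd hp (q ^ 2)
  have h3 := qPochInf_neg_sq_mul hq1
  have hP := qPochInf_ne_zero_of_norm_lt hp hp
  rw [show q ^ 2 * q ^ 2 = q ^ 4 by ring, show (q ^ 2) ^ 2 = q ^ 4 by ring, ← h3] at h2
  rw [show (q ^ 2) ^ 2 = q ^ 4 by ring] at h1
  refine mul_right_cancel₀ hP ?_
  linear_combination qPochInf (-q ^ 2) (q ^ 2) * qPochInf (q ^ 2) (q ^ 2) * h1 + h2

/-- Each of the three factors of Euler's product occurs squared. This rewrites the reciprocal thetas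
from the partial fractions as J_{1,2}. -/
theorem theta_mul_theta_mul_theta {q : ℂ} (hq0 : q ≠ 0) (hq1 : ‖q‖ < 1) :
    theta (-1) (q ^ 2) * theta (-q) (q ^ 2) * theta q (q ^ 2)
      = 2 * qPochInf (q ^ 2) (q ^ 2) ^ 3 := by
  have h := euler_product hq1
  rw [theta_neg_one (norm_sq_lt_one hq1), theta_half hq0, theta_neg_half hq0]
  linear_combination 2 * qPochInf (q ^ 2) (q ^ 2) ^ 3 *
    (qPochInf (-q ^ 2) (q ^ 2) * qPochInf q (q ^ 2) * qPochInf (-q) (q ^ 2) + 1) * h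

theorem theta_neg_inv {q : ℂ} (hq0 : q ≠ 0) (hq1 : ‖q‖ < 1) :
    q * theta (-q⁻¹) (q ^ 2) = theta (-q) (q ^ 2) := by
  have hp := norm_sq_lt_one hq1
  have h1 := qPochInf_eq_mul hp (-q⁻¹)
  have h2 := qPochInf_eq_mul hp (-q)
  rw [show q ^ 2 * -q⁻¹ = -q by field_simp] at h1
  rw [show q ^ 2 * -q = -q ^ 3 by ring] at h2
  rw [theta_neg_half hq0, theta, show q ^ 2 / -q⁻¹ = -q ^ 3 by field_simp, h1]
  have h3 : q * (1 - -q⁻¹) = 1 - -q := by field_simp; ring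
  linear_combination (qPochInf (-q) (q ^ 2) * qPochInf (-q ^ 3) (q ^ 2) *
    qPochInf (q ^ 2) (q ^ 2)) * h3 - qPochInf (-q) (q ^ 2) * qPochInf (q ^ 2) (q ^ 2) * h2

theorem Jm_eq_qPochInf (m : ℕ) (q : ℂ) : Jm m q = qPochInf (q ^ m) (q ^ m) := by
  refine tprod_congr fun i => ?_
  rw [← pow_succ, ← pow_mul]

theorem norm_pow_four_lt_one {q : ℂ} (hq1 : ‖q‖ < 1) : ‖q ^ 4‖ < 1 := by
  rw [norm_pow]; exact pow_lt_one₀ (norm_nonneg _) hq1 (by norm_num)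

/-- Here `altTheta q 0` is θ(q⁴;q⁸), and (q⁴;q⁸)_∞ (q⁸;q⁸)_∞ = (q⁴;q⁴)_∞ = (-q²;q²)_∞ (q²;q²)_∞. -/
theorem altTheta_zero {q : ℂ} (hq0 : q ≠ 0) (hq1 : ‖q‖ < 1) :
    2 * altTheta q 0 * qPochInf (q ^ 8) (q ^ 8)
      = theta (-1) (q ^ 2) * qPochInf (q ^ 2) (q ^ 2) := by
  have h4 := norm_pow_four_lt_one hq1
  have hq4 : q ^ 4 ≠ 0 := pow_ne_zero 4 hq0
  have h := jacobi_triple_product hq4 h4 hq4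
  have h1 : altTheta q 0 = theta (q ^ 4) ((q ^ 4) ^ 2) := by
    rw [← h, altTheta]
    refine tsum_congr fun b => ?_
    have e : q ^ (4 * b ^ 2 + 0 * b) = (q ^ 4) ^ (b ^ 2 - b) * (q ^ 4) ^ b := by
      simp only [← zpow_natCast, ← zpow_mul, ← zpow_add₀ hq0]; congr 1; push_cast; ring
    rw [e]
    ring
  have h2 := qPochInf_even_mul_odd h4 (q ^ 4)
  have h3 := qPochInf_neg_sq_mul hq1
  rw [h1, theta_half hq4, theta_neg_one (norm_sq_lt_one hq1)]
  rw [show q ^ 4 * q ^ 4 = q ^ 8 by ring, show (q ^ 4) ^ 2 = q ^ 8 by ring, ← h3] at h2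
  rw [show (q ^ 4) ^ 2 = q ^ 8 by ring]
  linear_combination 2 * (qPochInf (q ^ 4) (q ^ 8) * qPochInf (q ^ 8) (q ^ 8)
    + qPochInf (-q ^ 2) (q ^ 2) * qPochInf (q ^ 2) (q ^ 2)) * h2

theorem tsum_zpow_sq_sub {q : ℂ} (hq0 : q ≠ 0) (hq1 : ‖q‖ < 1) :
    ∑' a : ℤ, q ^ (a ^ 2 - a) = theta (-1) (q ^ 2) := by
  rw [← jacobi_triple_product hq0 hq1 (by norm_num)]
  refine tsum_congr fun a => ?_
  rw [mul_right_comm, ← mul_zpow]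
  simp

theorem tsum_zpow_eq_theta {q : ℂ} (hq0 : q ≠ 0) (hq1 : ‖q‖ < 1) (u : ℤ) :
    ∑' b : ℤ, (-1) ^ b * q ^ (4 * b ^ 2 + u * b) * (-q⁻¹) ^ b = theta (-q ^ (5 - u)) (q ^ 8) := by
  have h4 := norm_pow_four_lt_one hq1
  have hx : -q ^ (u + 3) ≠ 0 := neg_ne_zero.2 (zpow_ne_zero _ hq0)
  have h := jacobi_triple_product (pow_ne_zero 4 hq0) h4 hx
  rw [show (q ^ 4) ^ 2 = q ^ 8 by ring, ← theta_symm (pow_ne_zero 8 hq0)] at h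
  have e0 : q ^ 8 / -q ^ (u + 3) = -q ^ (5 - u) := by
    rw [div_neg, ← zpow_natCast, ← zpow_sub₀ hq0]
    congr 2
    push_cast
    ring
  rw [← e0, ← h]
  refine tsum_congr fun b => ?_
  have e : q ^ (4 * b ^ 2 + u * b) * q⁻¹ ^ b = (q ^ 4) ^ (b ^ 2 - b) * (q ^ (u + 3)) ^ b := by
    rw [inv_zpow, ← zpow_neg]
    simp only [← zpow_natCast, ← zpow_mul, ← zpow_add₀ hq0]; congr 1; push_cast; ring
  rw [neg_eq_neg_one_mul q⁻¹, neg_eq_neg_one_mul (q ^ (u + 3)), mul_zpow, mul_zpow]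
  linear_combination ((-1) ^ b * (-1) ^ b) * e

/-! ### Evaluation of the Lambert-type series -/

/-- The series `∑_k q^{k² - k} altTheta(u - 2k) / (1 + q^{2k-1})`. -/
def lambertTheta (q : ℂ) (u : ℤ) : ℂ :=
  ∑' k : ℤ, q ^ (k ^ 2 - k) * altTheta q (u - 2 * k) * (1 + q ^ (2 * k - 1))⁻¹

theorem one_sub_neg_inv_mul {q : ℂ} (hq0 : q ≠ 0) (k : ℤ) :
    1 - -q⁻¹ * (q ^ 2) ^ k = 1 + q ^ (2 * k - 1) := by
  rw [zpow_sub_one₀ hq0, zpow_mul]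
  norm_cast
  ring

theorem exists_norm_inv_one_add_le {q : ℂ} (hq0 : q ≠ 0) (hq1 : ‖q‖ < 1) :
    ∃ C, ∀ k : ℤ, ‖(1 + q ^ (2 * k - 1))⁻¹‖ ≤ C := by
  simpa only [one_sub_neg_inv_mul hq0] using
    exists_norm_inv_one_sub_le (-q⁻¹) (pow_ne_zero 2 hq0) (norm_sq_lt_one hq1)

/-- Under k ↦ 1 - k the second half becomes the first: the quasi-period of `altTheta` supplies the
sign, and its power of q is absorbed in passing from 1 + q^{1-2k} to 1 + q^{2k-1}. -/
theorem tsum_reflect_eq {q : ℂ} (hq0 : q ≠ 0) (hq1 : ‖q‖ < 1) (u : ℤ) :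
    ∑' k : ℤ, q ^ (k ^ 2 - k) * (altTheta q (u - 2 * k) - q ^ (5 - u) * altTheta q (10 - u - 2 * k)) *
        (1 + q ^ (2 * k - 1))⁻¹ = 2 * lambertTheta q u := by
  have hb := exists_norm_inv_one_add_le hq0 hq1
  have h1 : ∀ k : ℤ, q ^ (k ^ 2 - k) *
      (altTheta q (u - 2 * k) - q ^ (5 - u) * altTheta q (10 - u - 2 * k)) * (1 + q ^ (2 * k - 1))⁻¹
      = q ^ (k ^ 2 - k) * altTheta q (u - 2 * k) * (1 + q ^ (2 * k - 1))⁻¹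
        - q ^ (5 - u) * (q ^ (k ^ 2 - k) * altTheta q (10 - u - 2 * k) * (1 + q ^ (2 * k - 1))⁻¹) :=
    fun k => by ring
  have h2 : q ^ (5 - u) * ∑' k : ℤ, q ^ (k ^ 2 - k) * altTheta q (10 - u - 2 * k) *
      (1 + q ^ (2 * k - 1))⁻¹ = -lambertTheta q u := by
    rw [← (Equiv.subLeft (1 : ℤ)).tsum_eq, ← tsum_mul_left, lambertTheta, ← tsum_neg]
    refine tsum_congr fun k => ?_
    have a1 := altTheta_add_eight_mul hq0 (u - 8 - 2 * k) 1
    have n1 := one_add_zpow_ne_zero hq1 (m := 2 * k - 1) (by omega)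
    have n2 := one_add_zpow_ne_zero hq1 (m := 2 * (1 - k) - 1) (by omega)
    rw [show u - 8 - 2 * k + 8 * 1 = u - 2 * k by ring, zpow_one] at a1
    simp only [Equiv.subLeft_apply]
    rw [a1, ← altTheta_neg q (10 - u - 2 * (1 - k)),
      show -(10 - u - 2 * (1 - k)) = u - 8 - 2 * k by ring,
      show (1 - k) ^ 2 - (1 - k) = k ^ 2 - k by ring]
    have e1 : q ^ (5 - u) * (1 + q ^ (2 * k - 1))
        = q ^ (-4 * 1 ^ 2 - (u - 8 - 2 * k) * 1) * (1 + q ^ (2 * (1 - k) - 1)) := by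
      rw [mul_add, mul_add, mul_one, mul_one, ← zpow_add₀ hq0, ← zpow_add₀ hq0, add_comm]
      congr 2 <;> ring
    field_simp
    linear_combination altTheta q (u - 8 - 2 * k) * e1
  rw [tsum_congr h1, Summable.tsum_sub (summable_altTheta_mul hq0 hq1 u hb)
    ((summable_altTheta_mul hq0 hq1 (10 - u) hb).mul_left _), tsum_mul_left, h2, lambertTheta]
  ring

theorem tsum_alternating_lambertTheta {q : ℂ} (hq0 : q ≠ 0) (hq1 : ‖q‖ < 1) (u : ℤ) :
    theta (-q) (q ^ 2) * ∑' k : ℤ, q ^ (k ^ 2 - k) * altTheta q (u - 2 * k) *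
        ((-1) ^ k * (1 + q ^ (2 * k - 1))⁻¹)
      = -(theta (-q ^ (5 - u)) (q ^ 8) * qPochInf (q ^ 2) (q ^ 2) ^ 3) := by
  have hx0 : -q⁻¹ ≠ 0 := neg_ne_zero.2 (inv_ne_zero hq0)
  have hx : ∀ k : ℤ, 1 - -q⁻¹ * (q ^ 2) ^ k ≠ 0 := fun k => by
    rw [one_sub_neg_inv_mul hq0]
    exact one_add_zpow_ne_zero hq1 (by omega)
  have h1 := tsum_altTheta_mul_partial_fractions hq0 hq1 hx0 hx u
  have h2 := theta_mul_partial_fractions hq0 hq1 hx0 hx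
  rw [tsum_zpow_eq_theta hq0 hq1] at h1
  have h3 : ∑' k : ℤ, q ^ (k ^ 2 - k) * altTheta q (u - 2 * k) *
        ((-1) ^ k * (1 + q ^ (2 * k - 1))⁻¹) = ∑' k : ℤ, (-1) ^ k * q ^ (k ^ 2 - k) *
        altTheta q (u - 2 * k) * (1 - -q⁻¹ * (q ^ 2) ^ k)⁻¹ := by
    refine tsum_congr fun k => ?_
    rw [one_sub_neg_inv_mul hq0]
    ring
  rw [h3, h1, ← h2, ← theta_neg_inv hq0 hq1]
  field_simp

theorem one_sub_neg_mul {q : ℂ} (hq0 : q ≠ 0) (m : ℕ) (k : ℤ) :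
    1 - -q ^ m * ((q ^ 4) ^ 2) ^ k = 1 + q ^ (8 * k + m) := by
  have : q ^ (8 * k + m) = q ^ m * ((q ^ 4) ^ 2) ^ k := by
    simp only [← zpow_natCast, ← zpow_mul, ← zpow_add₀ hq0]; congr 1; push_cast; ring
  rw [this]
  ring

theorem lambertTheta_two {q : ℂ} (hq0 : q ≠ 0) (hq1 : ‖q‖ < 1) :
    lambertTheta q 2 = (∑' k : ℤ, q ^ (k ^ 2 - k) * altTheta q (2 - 2 * k) *
        ((-1) ^ k * (1 + q ^ (2 * k - 1))⁻¹))
      + 2 * altTheta q 0 * (qPochInf (q ^ 8) (q ^ 8) * (1 - q * g (-q) (q ^ 8))) := by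
  have hb := exists_norm_inv_one_add_le hq0 hq1
  have hz : ∀ k : ℤ, 1 - -q * ((q ^ 4) ^ 2) ^ k ≠ 0 := fun k => by
    have := one_sub_neg_mul hq0 1 k
    rw [pow_one] at this
    rw [this]
    exact one_add_zpow_ne_zero hq1 (by omega)
  have hg := qPochInf_mul_one_add_g (pow_ne_zero 4 hq0) (norm_pow_four_lt_one hq1) (neg_ne_zero.2 hq0) hz
  rw [show (q ^ 4) ^ 2 = q ^ 8 by ring, neg_mul, ← sub_eq_add_neg] at hg
  rw [hg, ← sub_eq_iff_eq_add', lambertTheta, ← Summable.tsum_sub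
    (summable_altTheta_mul hq0 hq1 2 hb) (summable_altTheta_mul hq0 hq1 2
      (exists_norm_le_mul (exists_norm_negOnePow_le fun k => k) hb)), ← tsum_mul_left]
  -- Only k ≡ 1 mod 4 survives: even k cancel against the twist, and k ≡ 3 meets the zero
  -- `altTheta_four`.
  have hinj : Function.Injective fun l : ℤ => 4 * l + 1 := fun a b h => by
    simp only at h; omega
  rw [← hinj.tsum_eq]
  · refine tsum_congr fun l => ?_
    have a1 := altTheta_add_eight_mul hq0 0 (-l)
    have s1 : (-1 : ℂ) ^ (4 * l + 1) = -1 := Odd.neg_one_zpow ⟨2 * l, by ring⟩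
    have s2 : (-1 : ℂ) ^ (-l) = (-1) ^ l := by
      rw [zpow_neg, ← inv_zpow]; norm_num
    have e1 := one_sub_neg_mul hq0 1 l
    rw [pow_one, show (q ^ 4) ^ 2 = q ^ 8 by ring] at e1
    have e2 : (q ^ 4) ^ (3 * l ^ 2 + l) = q ^ ((4 * l + 1) ^ 2 - (4 * l + 1)) *
        q ^ (-4 * (-l) ^ 2 - 0 * -l) := by
      simp only [← zpow_natCast, ← zpow_mul, ← zpow_add₀ hq0]; congr 1; push_cast; ring
    rw [show 2 - 2 * (4 * l + 1) = 0 + 8 * -l by ring, a1, s1, s2, e1, e2,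
      show 2 * (4 * l + 1) - 1 = 8 * l + (1 : ℕ) by push_cast; ring]
    ring
  · intro k hk
    by_contra hr
    apply hk
    rcases Int.even_or_odd k with he | ho
    · simp [he.neg_one_zpow]
    · obtain ⟨l, rfl⟩ : ∃ l, k = 4 * l + 3 := by
        obtain ⟨m, rfl⟩ := ho
        rcases Int.even_or_odd' m with ⟨l, rfl | rfl⟩
        · exact absurd ⟨l, by ring⟩ hr
        · exact ⟨l, by ring⟩
      have a1 := altTheta_add_eight_mul hq0 4 (-l - 1)
      rw [altTheta_four hq0, show 4 + 8 * (-l - 1) = 2 - 2 * (4 * l + 3) by ring] at a1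
      simp [a1]

theorem lambertTheta_four {q : ℂ} (hq0 : q ≠ 0) (hq1 : ‖q‖ < 1) :
    lambertTheta q 4 = -(∑' k : ℤ, q ^ (k ^ 2 - k) * altTheta q (4 - 2 * k) *
        ((-1) ^ k * (1 + q ^ (2 * k - 1))⁻¹))
      + 2 * altTheta q 0 * (q ^ 2 * (qPochInf (q ^ 8) (q ^ 8) * g (-q ^ 3) (q ^ 8))) := by
  have hb := exists_norm_inv_one_add_le hq0 hq1
  have hz : ∀ k : ℤ, 1 - -q ^ 3 * ((q ^ 4) ^ 2) ^ k ≠ 0 := fun k => by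
    rw [one_sub_neg_mul hq0 3 k]
    exact one_add_zpow_ne_zero hq1 (by omega)
  have hg := qPochInf_mul_g_eq_appell (pow_ne_zero 4 hq0) (norm_pow_four_lt_one hq1)
    (neg_ne_zero.2 (pow_ne_zero 3 hq0)) hz
  rw [show (q ^ 4) ^ 2 = q ^ 8 by ring] at hg
  rw [hg, ← sub_eq_iff_eq_add', sub_neg_eq_add, lambertTheta, ← Summable.tsum_add
    (summable_altTheta_mul hq0 hq1 4 hb) (summable_altTheta_mul hq0 hq1 4
      (exists_norm_le_mul (exists_norm_negOnePow_le fun k => k) hb)), ← mul_assoc, ← tsum_mul_left]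
  -- Odd k now cancel, and k ≡ 0 mod 4 meets the zero of `altTheta`.
  have hinj : Function.Injective fun l : ℤ => 4 * l + 2 := fun a b h => by
    simp only at h; omega
  rw [← hinj.tsum_eq]
  · refine tsum_congr fun l => ?_
    have a1 := altTheta_add_eight_mul hq0 0 (-l)
    have s1 : (-1 : ℂ) ^ (4 * l + 2) = 1 := Even.neg_one_zpow ⟨2 * l + 1, by ring⟩
    have s2 : (-1 : ℂ) ^ (-l) = (-1) ^ l := by
      rw [zpow_neg, ← inv_zpow]; norm_num
    have e1 := one_sub_neg_mul hq0 3 l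
    rw [show (q ^ 4) ^ 2 = q ^ 8 by ring] at e1
    have e2 : q ^ 2 * (q ^ 4) ^ (3 * l ^ 2 + 3 * l) = q ^ ((4 * l + 2) ^ 2 - (4 * l + 2)) *
        q ^ (-4 * (-l) ^ 2 - 0 * -l) := by
      simp only [← zpow_natCast, ← zpow_mul, ← zpow_add₀ hq0]; congr 1; push_cast; ring
    rw [show 4 - 2 * (4 * l + 2) = 0 + 8 * -l by ring, a1, s1, s2, e1,
      show 2 * (4 * l + 2) - 1 = 8 * l + (3 : ℕ) by push_cast; ring]
    linear_combination (-2 * altTheta q 0 * (-1) ^ l * (1 + q ^ (8 * l + (3 : ℕ)))⁻¹) * e2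
  · intro k hk
    by_contra hr
    apply hk
    rcases Int.even_or_odd k with he | ho
    · obtain ⟨l, rfl⟩ : ∃ l, k = 4 * l := by
        obtain ⟨m, rfl⟩ := he
        rcases Int.even_or_odd' m with ⟨l, rfl | rfl⟩
        · exact ⟨l, by ring⟩
        · exact absurd ⟨l, by ring⟩ hr
      have a1 := altTheta_add_eight_mul hq0 4 (-l)
      rw [altTheta_four hq0, show 4 + 8 * -l = 4 - 2 * (4 * l) by ring] at a1
      simp [a1]
    · simp [ho.neg_one_zpow]

/-! ### Assembly of the two identities -/

/-- The two exponents are exchanged by r ↦ -r - 1, which is the antisymmetry that the telescoping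
requires. The value α = 1 gives ψ̄₀ and α = 3 gives ψ̄₁. -/
theorem theta_mul_tsum_tailSum_sub {q : ℂ} (hq0 : q ≠ 0) (hq1 : ‖q‖ < 1) {α : ℤ} (h0 : 0 ≤ α)
    (h4 : α ≤ 4) :
    theta (-1) (q ^ 2) * ∑' j : ℤ, (-1) ^ j * q ^ (-j ^ 2) *
        tailSum (fun r => q ^ (4 * r ^ 2 + α * r) - q ^ (4 * r ^ 2 + (8 - α) * r + (4 - α))) j
      = 2 * lambertTheta q (α + 1) := by
  have hq : 0 < ‖q‖ := norm_pos_iff.2 hq0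
  rw [← tsum_zpow_sq_sub hq0 hq1, tsum_mul_tsum_tailSum hq0 hq1 (C := 2), ← tsum_reflect_eq hq0 hq1]
  · refine tsum_congr fun k => ?_
    congr 2
    rw [altTheta, altTheta, ← tsum_mul_left, ← Summable.tsum_sub (summable_altTheta hq0 hq1 _)
      ((summable_altTheta hq0 hq1 _).mul_left _)]
    refine tsum_congr fun b => ?_
    have e1 : q ^ (4 * b ^ 2 + (α + 1 - 2 * k) * b)
        = q ^ (b - 2 * k * b) * q ^ (4 * b ^ 2 + α * b) := by
      rw [← zpow_add₀ hq0]; congr 1; ring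
    have e2 : q ^ (5 - (α + 1)) * q ^ (4 * b ^ 2 + (10 - (α + 1) - 2 * k) * b)
        = q ^ (b - 2 * k * b) * q ^ (4 * b ^ 2 + (8 - α) * b + (4 - α)) := by
      rw [← zpow_add₀ hq0, ← zpow_add₀ hq0]; congr 1; ring
    linear_combination (-1) ^ b * (e2 - e1)
  · intro r
    have hle : ∀ m : ℤ, 4 * (r : ℤ) ^ 2 ≤ m → ‖q ^ m‖ ≤ ‖q‖ ^ (4 * r ^ 2) := fun m hm => by
      rw [norm_zpow, ← zpow_natCast]
      exact zpow_le_zpow_right_of_le_one₀ hq hq1.le (by push_cast; exact hm)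
    have hr : (0 : ℤ) ≤ r := Int.natCast_nonneg r
    refine (norm_sub_le _ _).trans ?_
    rw [two_mul]
    exact add_le_add (hle _ (by nlinarith)) (hle _ (by nlinarith))
  · intro r
    simp only [neg_sub]
    congr 2 <;> ring

theorem psiBar₀_eq {q : ℂ} (hq0 : q ≠ 0) (hq1 : ‖q‖ < 1) :
    psiBar₀ q = 2 - 2 * q * g (-q) (q ^ 8) - J 1 2 q * Jbar 3 8 q / Jm 2 q := by
  have h1 := theta_mul_tsum_tailSum_sub hq0 hq1 (α := 1) (by norm_num) (by norm_num)
  simp only [one_mul, show (8 : ℤ) - 1 = 7 by norm_num, show (4 : ℤ) - 1 = 3 by norm_num,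
    show (1 : ℤ) + 1 = 2 by norm_num] at h1
  rw [← qPochInf_mul_psiBar₀ hq0 hq1, lambertTheta_two hq0 hq1] at h1
  have h2 := tsum_alternating_lambertTheta hq0 hq1 2
  rw [show (5 : ℤ) - 2 = 3 by norm_num, zpow_ofNat] at h2
  have h3 := theta_mul_theta_mul_theta hq0 hq1
  have h4 := altTheta_zero hq0 hq1
  have hP := qPochInf_ne_zero_of_norm_lt (norm_sq_lt_one hq1) (norm_sq_lt_one hq1)
  have hne : theta (-1) (q ^ 2) * theta (-q) (q ^ 2) * theta q (q ^ 2) ≠ 0 := by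
    rw [h3]; exact mul_ne_zero two_ne_zero (pow_ne_zero 3 hP)
  have n1 := left_ne_zero_of_mul (left_ne_zero_of_mul hne)
  have n2 := right_ne_zero_of_mul (left_ne_zero_of_mul hne)
  rw [Jm_eq_qPochInf, J, Jbar, zpow_one, zpow_ofNat]
  generalize ∑' k : ℤ, q ^ (k ^ 2 - k) * altTheta q (2 - 2 * k) *
    ((-1) ^ k * (1 + q ^ (2 * k - 1))⁻¹) = X at *
  field_simp
  -- The factors θ(-1;q²) and θ(-q;q²) clear the denominators from the convolution and from the
  -- partial fractions.
  refine mul_left_cancel₀ (mul_ne_zero n1 n2) ?_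
  linear_combination theta (-q) (q ^ 2) * h1 + 2 * h2
    + 2 * theta (-q) (q ^ 2) * (1 - q * g (-q) (q ^ 8)) * h4 + theta (-q ^ 3) (q ^ 8) * h3

theorem psiBar₁_eq {q : ℂ} (hq0 : q ≠ 0) (hq1 : ‖q‖ < 1) :
    psiBar₁ q = 2 * q ^ 2 * g (-q ^ 3) (q ^ 8) + J 1 2 q * Jbar 1 8 q / Jm 2 q := by
  have h1 := theta_mul_tsum_tailSum_sub hq0 hq1 (α := 3) (by norm_num) (by norm_num)
  simp only [show (8 : ℤ) - 3 = 5 by norm_num, show (4 : ℤ) - 3 = 1 by norm_num,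
    show (3 : ℤ) + 1 = 4 by norm_num] at h1
  rw [← qPochInf_mul_psiBar₁ hq0 hq1, lambertTheta_four hq0 hq1] at h1
  have h2 := tsum_alternating_lambertTheta hq0 hq1 4
  rw [show (5 : ℤ) - 4 = 1 by norm_num, zpow_one] at h2
  have h3 := theta_mul_theta_mul_theta hq0 hq1
  have h4 := altTheta_zero hq0 hq1
  have hP := qPochInf_ne_zero_of_norm_lt (norm_sq_lt_one hq1) (norm_sq_lt_one hq1)
  have hne : theta (-1) (q ^ 2) * theta (-q) (q ^ 2) * theta q (q ^ 2) ≠ 0 := by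
    rw [h3]; exact mul_ne_zero two_ne_zero (pow_ne_zero 3 hP)
  have n1 := left_ne_zero_of_mul (left_ne_zero_of_mul hne)
  have n2 := right_ne_zero_of_mul (left_ne_zero_of_mul hne)
  rw [Jm_eq_qPochInf, J, Jbar, zpow_one]
  generalize ∑' k : ℤ, q ^ (k ^ 2 - k) * altTheta q (4 - 2 * k) *
    ((-1) ^ k * (1 + q ^ (2 * k - 1))⁻¹) = X at *
  field_simp
  refine mul_left_cancel₀ (mul_ne_zero n1 n2) ?_
  linear_combination theta (-q) (q ^ 2) * h1 - 2 * h2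
    + 2 * theta (-q) (q ^ 2) * q ^ 2 * g (-q ^ 3) (q ^ 8) * h4 - theta (-q) (q ^ 8) * h3

end MockTheta

end

theorem theorem1p4 (q : ℂ) (hq0 : q ≠ 0) (hq1 : ‖q‖ < 1) :
    MockTheta.psiBar₀ q
        = 2 - 2 * q * MockTheta.g (-q) (q ^ 8)
          - MockTheta.J 1 2 q * MockTheta.Jbar 3 8 q / MockTheta.Jm 2 q ∧
      MockTheta.psiBar₁ q
        = 2 * q ^ 2 * MockTheta.g (-q ^ 3) (q ^ 8)
          + MockTheta.J 1 2 q * MockTheta.Jbar 1 8 q / MockTheta.Jm 2 q :=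
  ⟨MockTheta.psiBar₀_eq hq0 hq1, MockTheta.psiBar₁_eq hq0 hq1⟩
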